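/- Let $n\ge 1$, $\operatorname{Im}\tau>0$ and $\theta[{a\atop b}](z,\tau)=\sum_{m\in\mathbb Z}\exp\big(\pi i(m+a)^2\tau+2\pi i(m+a)(z+b)\big)$. Put $\theta(z)=\theta[{1/2\atop 1/2}](z,\tau)$ and $\theta_j(z)=\theta[{1/2-j/n\atop 0}](n(z+\tfrac12),n\tau)$ for $j\in\mathbb Z/n\mathbb Z$. For $x\in\mathbb C^n$ let $\langle x,\bar\epsilon_k\rangle=x_k-\frac1n\sum_l x_l$, and let $$\phi_x(z)_i^k=\frac{\theta_i\big(\tfrac zn-\langle x,\bar\epsilon_k\rangle\big)}{\sqrt{-1}\,\boldsymbol\eta(\tau)},$$ where $\boldsymbol\eta(\tau)=e^{\pi i\tau/12}\prod_{m\ge1}(1-e^{2\pi i m\tau})$ is the Dedekind function (a number not to be confused with the parameter $\eta$ below). Let $\bar\phi_x(z)^{k,j}$ be the inverse matrix, $\sum_i\phi_x(z)_i^{k'}\bar\phi_x(z)^{k,i}=\delta_{k,k'}$. Let $\eta,u,v,c\in\mathbb C$ and $\lambda,\mu\in\mathbb C^n$ be such that $v=u+\sum_k(\lambda_k-\mu_k)$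 and the numbers $\theta(\lambda_i-\lambda_j)$, $\theta(\mu_i-\mu_j)$, $\theta(\mu_i-\mu_j+\frac\eta n)$ for $i\ne j$, and $\theta(\lambda_i-\mu_j)$ for all $i,j$, are nonzero. Put $$t_k=e^c\prod_s\frac{\theta(\lambda_k-\mu_s+\frac\eta n)}{\theta(\lambda_k-\mu_s)},\qquad \tilde t_k=e^c\prod_{m\ne k}\frac{\theta(\mu_m-\mu_k-\frac\eta n)}{\theta(\mu_m-\mu_k+\frac\eta n)}\prod_s\frac{\theta(\lambda_s-\mu_k+\frac\eta n)}{\theta(\lambda_s-\mu_k)},\qquad C_k=\prod_m\frac{\theta(\mu_m-\mu_k-\frac\eta n)}{\theta(\lambda_m-\mu_k)},$$ and $$L(z)_i^j=\sum_k\bar\phi_\lambda(z-v-\eta)^{k,j}\phi_\lambda(z-v)_i^k\,t_k,\quad \tilde L(z)_i^j=\sum_k\bar\phi_\mu(z-v-\eta)^{k,j}\phi_\mu(z-v)_i^k\,\tilde t_k,\quad M(z)_i^j=\sum_k\bar\phi_\mu(z-v-\eta)^{k,j}\phi_\mu(z-u)_i^k\,C_k.$$ (1) For every $z$ with $\theta(z-v-\eta)\ne0$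 the matrices $\phi_\lambda(z-v-\eta)$ and $\phi_\mu(z-v-\eta)$ are invertible, and the discrete Lax equation $\sum_jM(z)_j^{j'}L(z)_{i'}^j=\sum_i\tilde L(z)_i^{j'}M(z)_{i'}^i$ holds for all $i',j'$. (2) For an operator $A_i^j$ and $y,x\in\mathbb C^n$ put $A^{y,x}_{k',k}=\sum_{i,j}\phi_y(z-v-\eta)_j^{k'}\,\bar\phi_x(z-v-\eta)^{k,i}A_i^j$. For the same $z$, and with $w=z-v-\eta$, the degree-zero gauge forms $L(z)_{k',k}=L(z)^{\lambda,\lambda}_{k',k}$, $\tilde L(z)_{k',k}=\tilde L(z)^{\mu,\mu}_{k',k}$, $M(z)_{k',k}=M(z)^{\mu,\lambda}_{k',k}$ are all of the form $$\frac{\theta(w+x_k-y_{k'}+\frac\eta n)}{\theta(w)}\prod_{l\ne k}\frac{\theta(x_l-y_{k'}+\frac\eta n)}{\theta(x_l-x_k)}\,a_{k'},$$ with $(y,x,a)=(\lambda,\lambda,t)$, $(\mu,\mu,\tilde t)$, $(\mu,\lambda,C)$ respectively. (3) Let $s_\mu(x)=\prod_l\theta(x-\mu_l)$. If $\theta(u-v-\eta)\ne0$,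 then for every $k'$ $$\sum_kL(u)_{k',k}\,s_\mu(\lambda_k+\tfrac\eta n)=e^c\,s_\mu(\lambda_{k'}+\tfrac\eta n),\qquad \sum_kM(u)_{k',k}\,s_\mu(\lambda_k+\tfrac\eta n)=0,$$ and the vector $(s_\mu(\lambda_k+\frac\eta n))_k$ is nonzero (so it is an eigenvector of $L(u)$) whenever some $t_k\neq0$. -/

import Mathlib

open scoped Matrix

noncomputable section

namespace EllipticRS

/-- The theta function with characteristics
`θ[a; b](z, τ) = ∑_{m ∈ ℤ} exp (π i (m + a)² τ + 2 π i (m + a) (z + b))`. -/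
def thetaChar (a b z τ : ℂ) : ℂ :=
  ∑' m : ℤ, Complex.exp (Real.pi * Complex.I * (m + a) ^ 2 * τ
    + 2 * Real.pi * Complex.I * (m + a) * (z + b))

/-- The odd theta function `θ(z) = θ[1/2; 1/2](z, τ)`. -/
def theta (τ z : ℂ) : ℂ := thetaChar (1 / 2) (1 / 2) z τ

/-- `θ_j(z) = θ[1/2 - j/n; 0](n (z + 1/2), n τ)`. It depends on `j` modulo `n` only; the index `j`
runs over the representatives `0, …, n - 1`. -/
def thetaIdx (n : ℕ) (τ : ℂ) (j : Fin n) (z : ℂ) : ℂ :=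
  thetaChar (1 / 2 - ((j : ℕ) : ℂ) / (n : ℂ)) 0 ((n : ℂ) * (z + 1 / 2)) ((n : ℂ) * τ)

/-- The pairing `⟨x, ε̄_k⟩ = x_k - (1/n) ∑_l x_l`. -/
def barCoord {n : ℕ} (x : Fin n → ℂ) (k : Fin n) : ℂ :=
  x k - (∑ l, x l) / (n : ℂ)

/-- The matrix of intertwining vectors, with row `i` and column `k`:
`φ(z)_{x,i}^{x + η ε̄_k} = θ_i(z/n - ⟨x, ε̄_k⟩) / (√-1 η(τ))`, with the Dedekind function `η(τ)`. -/
def phi {n : ℕ} (τ : ℂ) (x : Fin n → ℂ) (z : ℂ) : Matrix (Fin n) (Fin n) ℂ :=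
  Matrix.of fun i k => thetaIdx n τ i (z / (n : ℂ) - barCoord x k) /
    (Complex.I * ModularForm.eta τ)

/-- The inverse matrix, with row `k` and column `j`: `φ̄(z)_x^{x + η ε̄_k, j}`. -/
def phiBar {n : ℕ} (τ : ℂ) (x : Fin n → ℂ) (z : ℂ) : Matrix (Fin n) (Fin n) ℂ :=
  (phi τ x z)⁻¹

/-- The elliptic L-operator with coefficients `t_k`,
`L(z)_i^j = ∑_k φ̄(z-v-η)_x^{x + η ε̄_k, j} φ(z-v)_{x,i}^{x + η ε̄_k} t_k`.
Upper indices are rows and lower indices are columns, so that composition is the matrix product. -/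
def LOp {n : ℕ} (τ η v : ℂ) (x t : Fin n → ℂ) (z : ℂ) : Matrix (Fin n) (Fin n) ℂ :=
  Matrix.of fun j i => ∑ k, phiBar τ x (z - v - η) k j * phi τ x (z - v) i k * t k

/-- `M(z)_i^j = ∑_k φ̄(z-v-η)_μ^{μ + η ε̄_k, j} φ(z-u)_{μ,i}^{μ + η ε̄_k} C_k`,
with the same convention on indices. -/
def MOp {n : ℕ} (τ η u v : ℂ) (mu C : Fin n → ℂ) (z : ℂ) : Matrix (Fin n) (Fin n) ℂ :=
  Matrix.of fun j i => ∑ k, phiBar τ mu (z - v - η) k j * phi τ mu (z - u) i k * C k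

/-- `t_k = e^c ∏_s θ(λ_k - μ_s + η/n) / θ(λ_k - μ_s)`. -/
def tCoeff {n : ℕ} (τ η c : ℂ) (lam mu : Fin n → ℂ) (k : Fin n) : ℂ :=
  Complex.exp c * ∏ s, theta τ (lam k - mu s + η / (n : ℂ)) / theta τ (lam k - mu s)

/-- `t̃_k = e^c ∏_{m ≠ k} θ(μ_m - μ_k - η/n) / θ(μ_m - μ_k + η/n)
  · ∏_s θ(λ_s - μ_k + η/n) / θ(λ_s - μ_k)`. -/
def tTildeCoeff {n : ℕ} (τ η c : ℂ) (lam mu : Fin n → ℂ) (k : Fin n) : ℂ :=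
  Complex.exp c *
    (∏ m ∈ Finset.univ.erase k,
      theta τ (mu m - mu k - η / (n : ℂ)) / theta τ (mu m - mu k + η / (n : ℂ))) *
    ∏ s, theta τ (lam s - mu k + η / (n : ℂ)) / theta τ (lam s - mu k)

/-- `C_k = ∏_m θ(μ_m - μ_k - η/n) / θ(λ_m - μ_k)`; the product includes `m = k`. -/
def CCoeff {n : ℕ} (τ η : ℂ) (lam mu : Fin n → ℂ) (k : Fin n) : ℂ :=
  ∏ m, theta τ (mu m - mu k - η / (n : ℂ)) / theta τ (lam m - mu k)

/-- The passage to the degree-zero gauge: an operator `A` with entries `A_i^j` becomes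
`A_{k',k} = ∑_{i,j} φ(w)_{y,j}^{y + η ε̄_{k'}} φ̄(w)_x^{x + η ε̄_k, i} A_i^j`. -/
def degZero {n : ℕ} (τ : ℂ) (y x : Fin n → ℂ) (w : ℂ) (A : Matrix (Fin n) (Fin n) ℂ) :
    Matrix (Fin n) (Fin n) ℂ :=
  Matrix.of fun k' k => ∑ i, ∑ j, phi τ y w j k' * phiBar τ x w k i * A j i

/-- The explicit matrix with entries
`θ(w + x_k - y_{k'} + η/n) / θ(w) · ∏_{l ≠ k} θ(x_l - y_{k'} + η/n) / θ(x_l - x_k) · a_{k'}`. -/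
def explicitMatrix {n : ℕ} (τ η : ℂ) (y x : Fin n → ℂ) (w : ℂ) (a : Fin n → ℂ) :
    Matrix (Fin n) (Fin n) ℂ :=
  Matrix.of fun k' k => theta τ (w + x k - y k' + η / (n : ℂ)) / theta τ w *
    (∏ l ∈ Finset.univ.erase k,
      theta τ (x l - y k' + η / (n : ℂ)) / theta τ (x l - x k)) * a k'

/-- The column `(s_μ(λ_k + η/n))_k`, where `s_μ(x) = ∏_l θ(x - μ_l)`. -/
def sVec {n : ℕ} (τ η : ℂ) (lam mu : Fin n → ℂ) (k : Fin n) : ℂ :=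
  ∏ l, theta τ (lam k + η / (n : ℂ) - mu l)

end EllipticRS

end

/-!
# The discrete Lax equation of the elliptic Ruijsenaars-Schneider system

Everything rests on interpolation by theta functions of degree `N`: entire functions with the
quasi-periods of a product `∏ θ(z - c_i)` of `N` factors, with characteristic `∑ c_i = s`
(`IsTheta`). Such a function is determined by its values at `N` points `p_i` that are distinct
modulo the lattice, unless `∑ p_i - s` is a lattice point (`IsTheta.eq_zero_of_forall`): if it
vanishes there, its quotient by `∏ θ(z - p_i)` is entire with constant multipliers, hence an
exponential by Liouville's theorem, and the multipliers do not match those of an exponential. The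
quotient is entire because the zeros of `θ` are simple and lie on the lattice; this is read off
from the infinite product `thetaProd`, of which `θ` is a constant multiple, again by Liouville.

The uniqueness gives the Lagrange formula `IsTheta.interpolation`, and from it
`IsTheta.sum_residues`, the vanishing of the sum of the residues of the elliptic function
`g / ∏ θ(z - a_l)`.

The functions `θ_j` are theta functions of degree `n` and characteristic `0`, linearly independent
as eigenfunctions of the translation by `1 / n` with different eigenvalues. The columns of
`φ_x(w)` are, up to the common factor `1 / (√-1 η(τ))`, the values of `(θ_j)_j` at `n` points with
sum `w`, so uniqueness makes the matrix invertible (`isUnit_phi`), and the Lagrange coefficients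
are the entries of the matrices that express one family of intertwining vectors in another
(`phi_mul_explicitMatrix`). This yields the degree-zero gauge forms. Interpolating
`z ↦ ∏ θ(η/n - z - μ_l)` by the same formula gives the eigenvector and the kernel vector.

In terms of the explicit matrices the Lax equation says that two sums of values of `θ_i`, one over
the points `λ_k` and one over the points `μ_k`, agree. These are the two halves of the sum of the
residues of one elliptic function with simple poles at the `λ_k` and the `μ_k`
(`IsTheta.lax_identity`).
-/

open scoped Matrix

noncomputable section

namespace EllipticRS

open Complex Filter Topology

/-! ### Theta functions with characteristics -/

lemma thetaChar_eq_jacobi (a b z τ : ℂ) :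
    thetaChar a b z τ = cexp (Real.pi * I * a ^ 2 * τ + 2 * Real.pi * I * a * (z + b)) *
      jacobiTheta₂ (z + b + a * τ) τ := by
  rw [thetaChar, jacobiTheta₂, ← tsum_mul_left]
  congr 1 with m
  rw [jacobiTheta₂_term, ← Complex.exp_add]
  ring_nf

lemma differentiable_thetaChar {τ : ℂ} (hτ : 0 < τ.im) (a b : ℂ) :
    Differentiable ℂ fun z => thetaChar a b z τ := by
  simp_rw [thetaChar_eq_jacobi]
  intro z
  refine DifferentiableAt.mul (by fun_prop) ?_
  exact (differentiableAt_jacobiTheta₂_fst _ hτ).comp z (by fun_prop)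

lemma thetaChar_add_one (a b z τ : ℂ) :
    thetaChar a b (z + 1) τ = cexp (2 * Real.pi * I * a) * thetaChar a b z τ := by
  rw [thetaChar, thetaChar, ← tsum_mul_left]
  congr 1 with m
  rw [← Complex.exp_add, Complex.exp_eq_exp_iff_exists_int]
  exact ⟨m, by ring⟩

lemma thetaChar_add_tau (a b z τ : ℂ) :
    thetaChar a b (z + τ) τ =
      cexp (-(Real.pi * I * τ) - 2 * Real.pi * I * (z + b)) * thetaChar a b z τ := by
  rw [thetaChar, thetaChar, ← (Equiv.addRight (1 : ℤ)).tsum_eq (fun m : ℤ => cexp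
    (Real.pi * I * (m + a) ^ 2 * τ + 2 * Real.pi * I * (m + a) * (z + b))), ← tsum_mul_left]
  congr 1 with m
  rw [← Complex.exp_add, Equiv.coe_addRight]
  push_cast
  ring_nf

lemma differentiable_theta {τ : ℂ} (hτ : 0 < τ.im) : Differentiable ℂ (theta τ) :=
  differentiable_thetaChar hτ _ _

lemma theta_add_one (τ z : ℂ) : theta τ (z + 1) = -theta τ z := by
  rw [theta, theta, thetaChar_add_one,
    show 2 * (Real.pi : ℂ) * I * (1 / 2) = Real.pi * I by ring, Complex.exp_pi_mul_I]
  ring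

lemma theta_add_tau (τ z : ℂ) :
    theta τ (z + τ) = -cexp (-(Real.pi * I * τ) - 2 * Real.pi * I * z) * theta τ z := by
  rw [theta, theta, thetaChar_add_tau,
    show -(Real.pi * I * τ) - 2 * Real.pi * I * (z + 1 / 2) =
      (-(Real.pi * I * τ) - 2 * Real.pi * I * z) - Real.pi * I by ring, Complex.exp_sub_pi_mul_I]

@[simp] lemma theta_neg (τ z : ℂ) : theta τ (-z) = -theta τ z := by
  -- The substitution `m ↦ -1 - m` replaces `m + 1 / 2` by its negative.
  rw [theta, theta, thetaChar, thetaChar,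
    ← (Equiv.subLeft (-1 : ℤ)).tsum_eq (fun m : ℤ => cexp
    (Real.pi * I * (m + 1 / 2) ^ 2 * τ + 2 * Real.pi * I * (m + 1 / 2) * (-z + 1 / 2))),
    ← tsum_neg]
  congr 1 with m
  rw [Equiv.subLeft_apply, ← Complex.exp_add_pi_mul_I, Complex.exp_eq_exp_iff_exists_int]
  refine ⟨-1 - m, ?_⟩
  push_cast
  ring

@[simp] lemma theta_zero (τ : ℂ) : theta τ 0 = 0 := by
  have h := theta_neg τ 0
  rw [neg_zero] at h
  exact self_eq_neg.mp h

lemma theta_sub_comm (τ a b : ℂ) : theta τ (a - b) = -theta τ (b - a) := by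
  rw [← theta_neg, neg_sub]

/-- The zeroth Fourier coefficient of `z ↦ jacobiTheta₂ z τ` is `1`. -/
lemma integral_jacobiTheta₂ {τ : ℂ} (hτ : 0 < τ.im) :
    ∫ x in (0 : ℝ)..1, jacobiTheta₂ x τ = 1 := by
  have hc : ∀ m : ℤ, Continuous fun x : ℝ => jacobiTheta₂_term m x τ := fun m => by
    unfold jacobiTheta₂_term; fun_prop
  have hn : ∀ (m : ℤ) (x : ℝ), ‖jacobiTheta₂_term m x τ‖ = ‖jacobiTheta₂_term m 0 τ‖ := by
    intro m x
    simp [norm_jacobiTheta₂_term]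
  have hs : Summable fun m : ℤ => ‖jacobiTheta₂_term m 0 τ‖ :=
    ((summable_jacobiTheta₂_term_iff 0 τ).mpr hτ).norm
  have key := intervalIntegral.hasSum_integral_of_dominated_convergence (a := (0 : ℝ)) (b := 1)
    (μ := MeasureTheory.volume) (F := fun (m : ℤ) (x : ℝ) => jacobiTheta₂_term m x τ)
    (f := fun x : ℝ => jacobiTheta₂ x τ)
    (fun m _ => ‖jacobiTheta₂_term m 0 τ‖) (fun m => (hc m).aestronglyMeasurable)
    (fun m => Eventually.of_forall fun x _ => (hn m x).le)
    (Eventually.of_forall fun x _ => hs) (by simp)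
    (Eventually.of_forall fun x _ => hasSum_jacobiTheta₂_term x hτ)
  refine key.unique ?_
  have h0 : ∫ x in (0 : ℝ)..1, jacobiTheta₂_term 0 x τ = 1 := by simp [jacobiTheta₂_term]
  rw [← h0]
  refine hasSum_single (0 : ℤ) fun m hm => ?_
  · have h2 : (2 * Real.pi * I * m : ℂ) ≠ 0 := by
      simp [Real.pi_ne_zero, hm]
    have : ∀ x : ℝ, jacobiTheta₂_term m x τ =
        cexp (2 * Real.pi * I * m * x) * cexp (Real.pi * I * m ^ 2 * τ) := fun x => by
      rw [jacobiTheta₂_term, Complex.exp_add]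
    simp_rw [this]
    rw [intervalIntegral.integral_mul_const, integral_exp_mul_complex h2]
    have h1 : cexp (2 * Real.pi * I * m * (1 : ℝ)) = 1 := by
      rw [Complex.exp_eq_one_iff]; exact ⟨m, by push_cast; ring⟩
    rw [h1]
    simp

lemma exists_thetaChar_ne_zero {τ : ℂ} (hτ : 0 < τ.im) (a b : ℂ) :
    ∃ z, thetaChar a b z τ ≠ 0 := by
  by_contra! h
  have h0 : ∀ x : ℂ, jacobiTheta₂ x τ = 0 := fun x => by
    have := h (x - b - a * τ)
    rw [thetaChar_eq_jacobi, show x - b - a * τ + b + a * τ = x by ring] at this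
    exact (mul_eq_zero.mp this).resolve_left (Complex.exp_ne_zero _)
  have := integral_jacobiTheta₂ hτ
  simp [h0] at this

lemma exists_theta_ne_zero {τ : ℂ} (hτ : 0 < τ.im) : ∃ z, theta τ z ≠ 0 :=
  exists_thetaChar_ne_zero hτ _ _

lemma natCast_mul_im_pos {n : ℕ} (hn : 0 < n) {τ : ℂ} (hτ : 0 < τ.im) :
    0 < ((n : ℂ) * τ).im := by
  have : (0 : ℝ) < n := by exact_mod_cast hn
  simpa using mul_pos this hτ

lemma differentiable_thetaIdx {n : ℕ} (hn : 0 < n) {τ : ℂ} (hτ : 0 < τ.im) (j : Fin n) :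
    Differentiable ℂ (thetaIdx n τ j) := by
  have hnτ := natCast_mul_im_pos hn hτ
  exact (differentiable_thetaChar hnτ (1 / 2 - ((j : ℕ) : ℂ) / (n : ℂ)) 0).comp
    (show Differentiable ℂ fun z : ℂ => (n : ℂ) * (z + 1 / 2) by fun_prop)

lemma exists_thetaIdx_ne_zero {n : ℕ} (hn : 0 < n) {τ : ℂ} (hτ : 0 < τ.im) (j : Fin n) :
    ∃ z, thetaIdx n τ j z ≠ 0 := by
  have hnτ := natCast_mul_im_pos hn hτ
  obtain ⟨z, hz⟩ := exists_thetaChar_ne_zero hnτ (1 / 2 - ((j : ℕ) : ℂ) / (n : ℂ)) 0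
  have hn' : (n : ℂ) ≠ 0 := by exact_mod_cast hn.ne'
  refine ⟨z / n - 1 / 2, ?_⟩
  rwa [thetaIdx, sub_add_cancel, mul_div_cancel₀ _ hn']

/-- Translation by `1 / n` acts on the `θ_j` with pairwise different eigenvalues. -/
lemma thetaIdx_add_inv {n : ℕ} (hn : 0 < n) (τ : ℂ) (j : Fin n) (z : ℂ) :
    thetaIdx n τ j (z + 1 / n) =
      cexp (2 * Real.pi * I * (1 / 2 - ((j : ℕ) : ℂ) / (n : ℂ))) * thetaIdx n τ j z := by
  have hn' : (n : ℂ) ≠ 0 := by exact_mod_cast hn.ne'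
  rw [thetaIdx, thetaIdx, ← thetaChar_add_one]
  congr 1
  field_simp
  ring

lemma thetaIdx_add_one {n : ℕ} (hn : 0 < n) (τ : ℂ) (j : Fin n) (z : ℂ) :
    thetaIdx n τ j (z + 1) = (-1) ^ n * thetaIdx n τ j z := by
  have hn' : (n : ℂ) ≠ 0 := by exact_mod_cast hn.ne'
  have h : ∀ k : ℕ, thetaIdx n τ j (z + k / n) =
      cexp (2 * Real.pi * I * (1 / 2 - ((j : ℕ) : ℂ) / (n : ℂ))) ^ k * thetaIdx n τ j z := by
    intro k
    induction k with
    | zero => simp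
    | succ k ih =>
      rw [pow_succ', mul_assoc, ← ih, ← thetaIdx_add_inv hn]
      congr 1
      push_cast
      ring
  have h1 := h n
  rw [div_self hn'] at h1
  rw [h1, ← Complex.exp_nat_mul]
  congr 1
  rw [← Complex.exp_pi_mul_I, ← Complex.exp_nat_mul, Complex.exp_eq_exp_iff_exists_int]
  refine ⟨-(j : ℕ), ?_⟩
  push_cast
  field_simp
  ring

lemma thetaIdx_add_tau {n : ℕ} (τ : ℂ) (j : Fin n) (z : ℂ) :
    thetaIdx n τ j (z + τ) =
      (-1) ^ n * cexp (-(Real.pi * I * n * τ) - 2 * Real.pi * I * (n * z)) *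
        thetaIdx n τ j z := by
  rw [thetaIdx, thetaIdx, show (n : ℂ) * (z + τ + 1 / 2) = n * (z + 1 / 2) + n * τ by ring,
    thetaChar_add_tau]
  congr 1
  rw [← Complex.exp_pi_mul_I, ← Complex.exp_nat_mul, ← Complex.exp_add,
    Complex.exp_eq_exp_iff_exists_int]
  refine ⟨-n, ?_⟩
  push_cast
  ring

lemma linearIndependent_thetaIdx {n : ℕ} (hn : 0 < n) {τ : ℂ} (hτ : 0 < τ.im) :
    LinearIndependent ℂ (thetaIdx n τ) := by
  have hn' : (n : ℂ) ≠ 0 := by exact_mod_cast hn.ne'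
  let T : Module.End ℂ (ℂ → ℂ) := LinearMap.funLeft ℂ ℂ fun z : ℂ => z + 1 / n
  refine Module.End.eigenvectors_linearIndependent' T
    (fun j : Fin n => cexp (2 * Real.pi * I * (1 / 2 - ((j : ℕ) : ℂ) / (n : ℂ)))) ?_ _ ?_
  · intro i j hij
    obtain ⟨m, hm⟩ := Complex.exp_eq_exp_iff_exists_int.mp hij
    have h2 : (2 * Real.pi * I : ℂ) ≠ 0 := by simp [Real.pi_ne_zero]
    have h3 : ((j : ℕ) : ℂ) / n - ((i : ℕ) : ℂ) / n = m := by
      apply mul_left_cancel₀ h2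
      linear_combination hm
    have h4 : ((j : ℕ) : ℤ) - ((i : ℕ) : ℤ) = m * n := by
      have : ((j : ℕ) : ℂ) - ((i : ℕ) : ℂ) = m * n := by
        rw [← h3]; field_simp
      exact_mod_cast this
    have hi := i.2
    have hj := j.2
    have : ((j : ℕ) : ℤ) - ((i : ℕ) : ℤ) = 0 :=
      Int.eq_zero_of_abs_lt_dvd ⟨m, h4.trans (mul_comm _ _)⟩ (by rw [abs_lt]; omega)
    exact Fin.ext (by omega)
  · intro j
    refine Module.End.hasEigenvector_iff.mpr ⟨?_, ?_⟩
    · rw [Module.End.mem_eigenspace_iff]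
      funext z
      exact thetaIdx_add_inv hn τ j z
    · obtain ⟨z, hz⟩ := exists_thetaIdx_ne_zero hn hτ j
      exact fun h => hz (congrFun h z)

/-! ### Entire functions with theta quasi-periods -/

/-- `f` is an entire theta function of degree `N` and characteristic `s` for the lattice
`ℤ + ℤ τ`: it has the quasi-periods of a product `∏ θ(z - c_i)` of `N` factors with
`∑ c_i = s`. -/
structure IsTheta (τ : ℂ) (N : ℕ) (s : ℂ) (f : ℂ → ℂ) : Prop where
  differentiable : Differentiable ℂ f
  add_one : ∀ z, f (z + 1) = (-1) ^ N * f z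
  add_tau : ∀ z, f (z + τ) =
    (-1) ^ N * cexp (-(Real.pi * I * N * τ) - 2 * Real.pi * I * (N * z - s)) * f z

lemma isTheta_theta {τ : ℂ} (hτ : 0 < τ.im) : IsTheta τ 1 0 (theta τ) where
  differentiable := differentiable_theta hτ
  add_one z := by rw [theta_add_one]; ring
  add_tau z := by rw [theta_add_tau]; simp

/-! ### The product formula and the zeros of `θ` -/

/-- The product `∏_{m ≥ 0} (1 - q ^ m X)`. The factors are written as `1 + _`, as in the library
results on infinite products. -/
def qProd (q X : ℂ) : ℂ := ∏' m : ℕ, (1 + -(q ^ m * X))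

lemma summable_qProd {q : ℂ} (hq : ‖q‖ < 1) (X : ℂ) :
    Summable fun m : ℕ => ‖-(q ^ m * X)‖ := by
  simpa using (summable_geometric_of_lt_one (norm_nonneg _) hq).mul_right ‖X‖

lemma qProd_eq_mul {q : ℂ} (hq : ‖q‖ < 1) (X : ℂ) :
    qProd q X = (1 - X) * qProd q (q * X) := by
  have h : ∀ m : ℕ, 1 + -(q ^ (m + 1) * X) = 1 + -(q ^ m * (q * X)) := fun m => by ring
  rw [qProd, tprod_eq_zero_mul', qProd]
  · simp_rw [h]
    simp [sub_eq_add_neg]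
  · simp_rw [h]
    exact multipliable_one_add_of_summable (summable_qProd hq _)

lemma exists_of_qProd_eq_zero {q X : ℂ} (hq : ‖q‖ < 1) (h : qProd q X = 0) :
    ∃ m : ℕ, q ^ m * X = 1 := by
  by_contra! hne
  refine tprod_one_add_ne_zero_of_summable (f := fun m : ℕ => -(q ^ m * X)) (fun m hm => ?_)
    (summable_qProd hq X) h
  exact hne m (by linear_combination -hm)

lemma differentiable_qProd {q : ℂ} (hq : ‖q‖ < 1) : Differentiable ℂ (qProd q) := by
  intro X
  have hK : IsOpen (Metric.ball (0 : ℂ) (‖X‖ + 1)) := Metric.isOpen_ball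
  have h := (Summable.hasProdLocallyUniformlyOn_nat_one_add
    (f := fun (m : ℕ) (x : ℂ) => -(q ^ m * x)) hK
    ((summable_geometric_of_lt_one (norm_nonneg _) hq).mul_right (‖X‖ + 1))
    (Eventually.of_forall fun m x hx => by
      rw [norm_neg, norm_mul, norm_pow]
      exact mul_le_mul_of_nonneg_left (by simpa using (Metric.mem_ball.mp hx).le) (by positivity))
    (fun m => by fun_prop)).differentiableOn
    (.of_forall fun s => by
      simpa [Finset.prod_fn] using DifferentiableOn.finsetProd (fun _ _ ↦ by fun_prop)) hK
  exact h.differentiableAt (hK.mem_nhds (by simp))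

/-- The product
`e^{-π i z} (1 - x) ∏_{m ≥ 1} (1 - q ^ m x) (1 - q ^ m / x)` with `x = e^{2 π i z}` and
`q = e^{2 π i τ}`, which is proportional to `θ(z)`. -/
def thetaProd (τ z : ℂ) : ℂ :=
  cexp (-(Real.pi * I * z)) * (qProd (cexp (2 * Real.pi * I * τ)) (cexp (2 * Real.pi * I * z)) *
    qProd (cexp (2 * Real.pi * I * τ)) (cexp (2 * Real.pi * I * (τ - z))))

lemma norm_nome_lt_one {τ : ℂ} (hτ : 0 < τ.im) : ‖cexp (2 * Real.pi * I * τ)‖ < 1 := by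
  rw [Complex.norm_exp, Real.exp_lt_one_iff]
  simp
  positivity

lemma isTheta_thetaProd {τ : ℂ} (hτ : 0 < τ.im) : IsTheta τ 1 0 (thetaProd τ) where
  differentiable := by
    have h := differentiable_qProd (norm_nome_lt_one hτ)
    intro z
    refine DifferentiableAt.mul (by fun_prop) (DifferentiableAt.mul ?_ ?_)
    · exact (h _).comp z (by fun_prop)
    · exact (h _).comp z (by fun_prop)
  add_one z := by
    have h1 : cexp (2 * Real.pi * I * (z + 1)) = cexp (2 * Real.pi * I * z) :=
      Complex.exp_eq_exp_iff_exists_int.mpr ⟨1, by push_cast; ring⟩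
    have h2 : cexp (2 * Real.pi * I * (τ - (z + 1))) = cexp (2 * Real.pi * I * (τ - z)) :=
      Complex.exp_eq_exp_iff_exists_int.mpr ⟨-1, by push_cast; ring⟩
    have h3 : cexp (-(Real.pi * I * (z + 1))) = -cexp (-(Real.pi * I * z)) := by
      rw [← Complex.exp_sub_pi_mul_I]; ring_nf
    rw [thetaProd, h1, h2, h3, thetaProd]
    ring
  add_tau z := by
    have hq := norm_nome_lt_one hτ
    have h1 : cexp (2 * Real.pi * I * (z + τ)) =
        cexp (2 * Real.pi * I * τ) * cexp (2 * Real.pi * I * z) := by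
      rw [← Complex.exp_add]; ring_nf
    have h2 : cexp (2 * Real.pi * I * (τ - (z + τ))) = cexp (-(2 * Real.pi * I * z)) := by
      ring_nf
    have h3 : cexp (2 * Real.pi * I * (τ - z)) =
        cexp (2 * Real.pi * I * τ) * cexp (-(2 * Real.pi * I * z)) := by
      rw [← Complex.exp_add]; ring_nf
    have h4 : cexp (-(Real.pi * I * (1 : ℕ) * τ) - 2 * Real.pi * I * ((1 : ℕ) * z - 0)) *
        cexp (-(Real.pi * I * z)) =
        cexp (-(Real.pi * I * (z + τ))) * cexp (-(2 * Real.pi * I * z)) := by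
      rw [← Complex.exp_add, ← Complex.exp_add]
      push_cast
      ring_nf
    have h5 : cexp (-(2 * Real.pi * I * z)) * cexp (2 * Real.pi * I * z) = 1 := by
      rw [← Complex.exp_add]; simp
    rw [thetaProd, thetaProd, h1, h2, qProd_eq_mul hq (cexp (-(2 * Real.pi * I * z))), h3,
      qProd_eq_mul hq (cexp (2 * Real.pi * I * z))]
    generalize qProd _ (_ * cexp (2 * Real.pi * I * z)) = A
    generalize qProd _ (_ * cexp (-(2 * Real.pi * I * z))) = B
    linear_combination (1 - cexp (2 * Real.pi * I * z)) * A * B * h4 -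
      cexp (-(Real.pi * I * (z + τ))) * A * B * h5

lemma exists_int_of_thetaProd_eq_zero {τ z : ℂ} (hτ : 0 < τ.im) (h : thetaProd τ z = 0) :
    ∃ a b : ℤ, z = a + b * τ := by
  have hq := norm_nome_lt_one hτ
  have h2 : (2 * Real.pi * I : ℂ) ≠ 0 := by simp [Real.pi_ne_zero]
  rcases mul_eq_zero.mp ((mul_eq_zero.mp h).resolve_left (Complex.exp_ne_zero _)) with h | h <;>
  · obtain ⟨m, hm⟩ := exists_of_qProd_eq_zero hq h
    rw [← Complex.exp_nat_mul, ← Complex.exp_add, Complex.exp_eq_one_iff] at hm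
    obtain ⟨k, hk⟩ := hm
    first
    | refine ⟨k, -m, mul_left_cancel₀ h2 ?_⟩
      push_cast
      linear_combination hk
    | refine ⟨-k, m + 1, mul_left_cancel₀ h2 ?_⟩
      push_cast
      linear_combination -hk

/-- Translation by a lattice vector multiplies a theta function by a nowhere vanishing factor. -/
lemma IsTheta.exists_unit {τ : ℂ} {N : ℕ} {s : ℂ} {f : ℂ → ℂ} (hf : IsTheta τ N s f) (a b : ℤ) :
    ∃ C d : ℂ, C ≠ 0 ∧ ∀ z, f (z + (a + b * τ)) = C * cexp (d * z) * f z := by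
  have h1 : ∀ a : ℤ, ∃ C : ℂ, C ≠ 0 ∧ ∀ z, f (z + a) = C * f z := by
    intro a
    induction a with
    | zero => exact ⟨1, one_ne_zero, by simp⟩
    | succ k ih =>
      obtain ⟨C, hC, h⟩ := ih
      refine ⟨(-1) ^ N * C, by simp [hC], fun z => ?_⟩
      rw [mul_assoc, ← h, ← hf.add_one]
      push_cast
      ring_nf
    | pred k ih =>
      obtain ⟨C, hC, h⟩ := ih
      refine ⟨(-1) ^ N * C, by simp [hC], fun z => ?_⟩
      have h1 := hf.add_one (z + ((-k - 1 : ℤ) : ℂ))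
      rw [mul_assoc, ← h, show z + ((-k : ℤ) : ℂ) = z + ((-k - 1 : ℤ) : ℂ) + 1 by push_cast; ring,
        h1, ← mul_assoc, ← mul_pow]
      simp
  have h2 : ∀ b : ℤ, ∃ C d : ℂ, C ≠ 0 ∧ ∀ z, f (z + b * τ) = C * cexp (d * z) * f z := by
    intro b
    induction b with
    | zero => exact ⟨1, 0, one_ne_zero, by simp⟩
    | succ k ih =>
      obtain ⟨C, d, hC, h⟩ := ih
      refine ⟨(-1) ^ N * cexp (-(Real.pi * I * N * τ) - 2 * Real.pi * I * (N * (k * τ) - s)) * C,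
        d - 2 * Real.pi * I * N, by simp [hC, Complex.exp_ne_zero], fun z => ?_⟩
      have h3 := hf.add_tau (z + (k : ℤ) * τ)
      rw [h] at h3
      rw [show z + ((k + 1 : ℤ) : ℂ) * τ = z + ((k : ℤ) : ℂ) * τ + τ by push_cast; ring, h3]
      have : cexp (-(Real.pi * I * N * τ) - 2 * Real.pi * I * (N * (z + (k : ℤ) * τ) - s)) *
          cexp (d * z) = cexp (-(Real.pi * I * N * τ) - 2 * Real.pi * I * (N * (k * τ) - s)) *
          cexp ((d - 2 * Real.pi * I * N) * z) := by
        rw [← Complex.exp_add, ← Complex.exp_add]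
        push_cast
        ring_nf
      linear_combination ((-1) ^ N * C * f z) * this
    | pred k ih =>
      obtain ⟨C, d, hC, h⟩ := ih
      refine ⟨(-1) ^ N * C * cexp ((Real.pi * I * N * τ) +
          2 * Real.pi * I * (N * ((-k - 1) * τ) - s)),
        d + 2 * Real.pi * I * N, by simp [hC, Complex.exp_ne_zero], fun z => ?_⟩
      have h3 := hf.add_tau (z + ((-k - 1 : ℤ) : ℂ) * τ)
      rw [show z + ((-k - 1 : ℤ) : ℂ) * τ + τ = z + ((-k : ℤ) : ℂ) * τ by push_cast; ring, h] at h3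
      have h4 : cexp (-(Real.pi * I * N * τ) -
            2 * Real.pi * I * (N * (z + ((-k - 1 : ℤ) : ℂ) * τ) - s)) *
          cexp ((Real.pi * I * N * τ) + 2 * Real.pi * I * (N * ((-k - 1) * τ) - s)) *
          cexp (2 * Real.pi * I * N * z) = 1 := by
        rw [← Complex.exp_add, ← Complex.exp_add, Complex.exp_eq_one_iff]
        refine ⟨0, ?_⟩
        push_cast
        ring
      have h5 : ((-1 : ℂ) ^ N) * (-1) ^ N = 1 := by rw [← mul_pow]; simp
      have h6 : cexp ((d + 2 * Real.pi * I * N) * z) =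
          cexp (d * z) * cexp (2 * Real.pi * I * N * z) := by
        rw [← Complex.exp_add, add_mul]
      rw [h6]
      generalize cexp (-(Real.pi * I * N * τ) -
            2 * Real.pi * I * (N * (z + ((-k - 1 : ℤ) : ℂ) * τ) - s)) = A at *
      generalize f (z + ((-k - 1 : ℤ) : ℂ) * τ) = F at *
      generalize cexp ((Real.pi * I * N * τ) + 2 * Real.pi * I * (N * ((-k - 1) * τ) - s)) = B at *
      generalize cexp (2 * Real.pi * I * N * z) = D at *
      linear_combination (-F) * h4 - A * B * D * F * h5 - (-1) ^ N * B * D * h3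
  obtain ⟨C, hC, h⟩ := h1 a
  obtain ⟨C', d, hC', h'⟩ := h2 b
  refine ⟨C * C', d, mul_ne_zero hC hC', fun z => ?_⟩
  rw [show z + (a + b * τ) = z + b * τ + a by ring, h, h']
  ring

lemma IsTheta.eq_zero_add_lattice {τ : ℂ} {N : ℕ} {s : ℂ} {f : ℂ → ℂ} (hf : IsTheta τ N s f)
    {z : ℂ} (hz : f z = 0) (a b : ℤ) : f (z + (a + b * τ)) = 0 := by
  obtain ⟨C, d, -, h⟩ := hf.exists_unit a b
  rw [h, hz, mul_zero]

lemma theta_lattice {τ : ℂ} (hτ : 0 < τ.im) (a b : ℤ) : theta τ (a + b * τ) = 0 := by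
  simpa using (isTheta_theta hτ).eq_zero_add_lattice (theta_zero τ) a b

/-- The factor `1 - x` with `x = e^{2 π i z}` has a simple zero at `z = 0`, and the other factors
do not vanish there. -/
lemma deriv_thetaProd_zero_ne_zero {τ : ℂ} (hτ : 0 < τ.im) : deriv (thetaProd τ) 0 ≠ 0 := by
  have hq := norm_nome_lt_one hτ
  set q := cexp (2 * Real.pi * I * τ) with hqdef
  set E : ℂ → ℂ := fun z => cexp (-(Real.pi * I * z)) * (qProd q (q * cexp (2 * Real.pi * I * z)) *
    qProd q (cexp (2 * Real.pi * I * (τ - z)))) with hE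
  have hfac : thetaProd τ = fun z => (1 - cexp (2 * Real.pi * I * z)) * E z := by
    funext z
    rw [thetaProd, ← hqdef, qProd_eq_mul hq (cexp (2 * Real.pi * I * z)), hE]
    ring
  have hEd : DifferentiableAt ℂ E 0 := by
    have h := differentiable_qProd hq
    refine DifferentiableAt.mul (by fun_prop) (DifferentiableAt.mul ?_ ?_)
    · exact (h _).comp (0 : ℂ) (by fun_prop)
    · exact (h _).comp (0 : ℂ) (by fun_prop)
  have hq1 : qProd q q ≠ 0 := fun h => by
    obtain ⟨m, hm⟩ := exists_of_qProd_eq_zero hq h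
    have h1 : ‖q‖ ^ (m + 1) = 1 := by rw [← norm_pow, pow_succ, hm, norm_one]
    exact absurd h1 (pow_lt_one₀ (norm_nonneg _) hq (by omega)).ne
  have hE0 : E 0 ≠ 0 := by simp [hE, ← hqdef, hq1]
  have hd : HasDerivAt (fun z : ℂ => 1 - cexp (2 * Real.pi * I * z)) (-(2 * Real.pi * I)) 0 := by
    have := (((hasDerivAt_id (0 : ℂ)).const_mul (2 * Real.pi * I : ℂ)).cexp).const_sub 1
    simpa using this
  have := hd.mul hEd.hasDerivAt
  rw [hfac]
  erw [this.deriv]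
  simp [Real.pi_ne_zero, hE0]

/-- The zeros of `thetaProd` are simple: translation by a lattice vector carries the zero at the
origin to any other. -/
lemma deriv_thetaProd_ne_zero {τ z : ℂ} (hτ : 0 < τ.im) (hz : thetaProd τ z = 0) :
    deriv (thetaProd τ) z ≠ 0 := by
  obtain ⟨a, b, rfl⟩ := exists_int_of_thetaProd_eq_zero hτ hz
  have hQ := isTheta_thetaProd hτ
  obtain ⟨C, d, hC, h⟩ := hQ.exists_unit a b
  have h0 : thetaProd τ 0 = 0 := by
    have := h 0
    rw [zero_add, hz] at this
    simpa [hC] using this.symm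
  have h1 : HasDerivAt (fun z => thetaProd τ (z + (a + b * τ)))
      (deriv (thetaProd τ) (a + b * τ)) 0 := by
    have := (hQ.differentiable (0 + (a + b * τ))).hasDerivAt
    simpa using this.comp_add_const (0 : ℂ) (a + b * τ)
  have h2 : HasDerivAt (fun z => C * cexp (d * z) * thetaProd τ z)
      (C * deriv (thetaProd τ) 0) 0 := by
    have h3 : HasDerivAt (fun z : ℂ => C * cexp (d * z)) (C * d) 0 := by
      have := (((hasDerivAt_id (0 : ℂ)).const_mul d).cexp).const_mul C
      simpa using this
    exact (h3.mul (hQ.differentiable 0).hasDerivAt).congr_deriv (by simp [h0])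
  simp_rw [h] at h1
  rw [h1.unique h2]
  exact mul_ne_zero hC (deriv_thetaProd_zero_ne_zero hτ)

/-- An entire function that vanishes on the zeros of an entire function with simple zeros only is
divisible by it in the ring of entire functions. -/
lemma exists_differentiable_eq_mul {f g : ℂ → ℂ} (hf : Differentiable ℂ f)
    (hg : Differentiable ℂ g) (hsimple : ∀ z, g z = 0 → deriv g z ≠ 0)
    (hzero : ∀ z, g z = 0 → f z = 0) : ∃ h : ℂ → ℂ, Differentiable ℂ h ∧ ∀ z, f z = h z * g z := by
  classical
  -- At a zero of `g` the quotient takes the value given by l'Hôpital's rule.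
  refine ⟨fun z => if g z = 0 then deriv f z / deriv g z else f z / g z, fun z₀ => ?_, fun z => ?_⟩
  · by_cases hz : g z₀ = 0
    -- Near a zero of `g` the quotient is the quotient of the slope functions.
    · have hds : ∀ {k : ℂ → ℂ}, Differentiable ℂ k → Differentiable ℂ (dslope k z₀) := by
        intro k hk
        rw [← differentiableOn_univ]
        exact (Complex.differentiableOn_dslope univ_mem).mpr hk.differentiableOn
      have hg0 : dslope g z₀ z₀ ≠ 0 := by rw [dslope_same]; exact hsimple z₀ hz
      have hne : ∀ᶠ z in 𝓝 z₀, dslope g z₀ z ≠ 0 :=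
        (hds hg).continuous.continuousAt.eventually_ne hg0
      have key : (fun z => if g z = 0 then deriv f z / deriv g z else f z / g z) =ᶠ[𝓝 z₀]
          fun z => dslope f z₀ z / dslope g z₀ z := by
        filter_upwards [hne] with z hzne
        by_cases hzz : z = z₀
        · subst hzz
          simp [hz, dslope_same]
        · have hsub : z - z₀ ≠ 0 := sub_ne_zero.mpr hzz
          have e1 : g z = (z - z₀) * dslope g z₀ z := by
            have := sub_smul_dslope g z₀ z
            rw [hz, sub_zero, smul_eq_mul] at this
            exact this.symm
          have e2 : f z = (z - z₀) * dslope f z₀ z := by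
            have := sub_smul_dslope f z₀ z
            rw [hzero z₀ hz, sub_zero, smul_eq_mul] at this
            exact this.symm
          have e3 : g z ≠ 0 := by rw [e1]; exact mul_ne_zero hsub hzne
          rw [if_neg e3, e1, e2, mul_div_mul_left _ _ hsub]
      exact (((hds hf) z₀).div ((hds hg) z₀) hg0).congr_of_eventuallyEq key
    · have key : (fun z => if g z = 0 then deriv f z / deriv g z else f z / g z) =ᶠ[𝓝 z₀]
          fun z => f z / g z := by
        filter_upwards [hg.continuous.continuousAt.eventually_ne hz] with z hzne
        rw [if_neg hzne]
      exact ((hf z₀).div (hg z₀) hz).congr_of_eventuallyEq key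
  · by_cases hz : g z = 0
    · simp [hz, hzero z hz]
    · simp [hz]

/-- Every point is congruent modulo the lattice to a point of the fundamental parallelogram. -/
lemma exists_int_reduction {τ : ℂ} (hτ : 0 < τ.im) (z : ℂ) :
    ∃ a b : ℤ, ∃ x ∈ Set.Icc (0 : ℝ) 1, ∃ y ∈ Set.Icc (0 : ℝ) 1,
      z = (x + y * τ) + (a + b * τ) := by
  set y := z.im / τ.im
  set x := z.re - y * τ.re
  refine ⟨⌊x⌋, ⌊y⌋, Int.fract x, ⟨Int.fract_nonneg _, (Int.fract_lt_one _).le⟩,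
    Int.fract y, ⟨Int.fract_nonneg _, (Int.fract_lt_one _).le⟩, ?_⟩
  have hx : ((Int.fract x : ℝ) : ℂ) + (⌊x⌋ : ℂ) = x := by exact_mod_cast Int.fract_add_floor x
  have hy : ((Int.fract y : ℝ) : ℂ) + (⌊y⌋ : ℂ) = y := by exact_mod_cast Int.fract_add_floor y
  have : z = x + y * τ := by
    apply Complex.ext
    · simp [x]
    · simp [y, hτ.ne']
  linear_combination this - hx - τ * hy

/-- An entire function whose absolute value is doubly periodic is constant. -/
lemma exists_eq_const_of_norm_periodic {τ : ℂ} (hτ : 0 < τ.im) {H : ℂ → ℂ}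
    (hH : Differentiable ℂ H) (h1 : ∀ z, ‖H (z + 1)‖ = ‖H z‖) (h2 : ∀ z, ‖H (z + τ)‖ = ‖H z‖) :
    ∃ C, ∀ z, H z = C := by
  apply hH.exists_const_forall_eq_of_bounded
  have p1 : Function.Periodic (fun z => ‖H z‖) 1 := h1
  have p2 : Function.Periodic (fun z => ‖H z‖) τ := h2
  have hcpt : IsCompact ((fun p : ℝ × ℝ => H (p.1 + p.2 * τ)) ''
      (Set.Icc (0 : ℝ) 1 ×ˢ Set.Icc (0 : ℝ) 1)) := by
    refine (isCompact_Icc.prod isCompact_Icc).image ?_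
    exact hH.continuous.comp (by fun_prop)
  obtain ⟨R, hR⟩ := hcpt.isBounded.exists_norm_le
  refine isBounded_iff_forall_norm_le.mpr ⟨R, ?_⟩
  rintro _ ⟨z, rfl⟩
  obtain ⟨a, b, x, hx, y, hy, rfl⟩ := exists_int_reduction hτ z
  have e1 : ‖H ((x + y * τ) + (a + b * τ))‖ = ‖H (x + y * τ)‖ := by
    have q1 := (p1.zsmul a) ((x + y * τ) + b * τ)
    have q2 := (p2.zsmul b) (x + y * τ)
    simp only [zsmul_eq_mul, mul_one] at q1 q2
    rw [← q2, ← q1]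
    ring_nf
  rw [e1]
  exact hR _ ⟨(x, y), ⟨hx, hy⟩, rfl⟩

/-- An entire function with period `1` and multiplier `e^{2 π i w}` under `z ↦ z + τ` is a
multiple of an exponential. -/
lemma exists_eq_const_mul_exp {τ : ℂ} (hτ : 0 < τ.im) {h : ℂ → ℂ} (hd : Differentiable ℂ h)
    (w : ℂ) (h1 : ∀ z, h (z + 1) = h z) (h2 : ∀ z, h (z + τ) = cexp (2 * Real.pi * I * w) * h z) :
    ∃ C, ∀ z, h z = C * cexp (I * (2 * Real.pi * w.im / τ.im : ℝ) * z) := by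
  set t : ℝ := 2 * Real.pi * w.im / τ.im with ht
  -- With this `t` the function `h z * e^{-i t z}` has multipliers of absolute value `1`.
  have hn1 : ∀ z, ‖h (z + 1) * cexp (-(I * t * (z + 1)))‖ = ‖h z * cexp (-(I * t * z))‖ := by
    intro z
    simp only [norm_mul, h1, Complex.norm_exp]
    simp
  have hn2 : ∀ z, ‖h (z + τ) * cexp (-(I * t * (z + τ)))‖ = ‖h z * cexp (-(I * t * z))‖ := by
    intro z
    rw [h2, mul_right_comm, mul_comm _ (h z), norm_mul, norm_mul (h z), ← Complex.exp_add]
    congr 1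
    rw [Complex.norm_exp, Complex.norm_exp]
    congr 1
    have : t * τ.im = 2 * Real.pi * w.im := by rw [ht]; field_simp
    simp
    linear_combination this
  obtain ⟨C, hC⟩ := exists_eq_const_of_norm_periodic hτ
    (H := fun z => h z * cexp (-(I * t * z))) (hd.mul (by fun_prop)) hn1 hn2
  refine ⟨C, fun z => ?_⟩
  rw [← hC z, mul_assoc, ← Complex.exp_add]
  simp

/-- The ring of entire functions has no zero divisors. -/
lemma mul_left_cancel_entire {f g k : ℂ → ℂ} (hf : Differentiable ℂ f) (hg : Differentiable ℂ g)
    (hk : Differentiable ℂ k) {z₀ : ℂ} (hz₀ : k z₀ ≠ 0) (h : ∀ z, k z * f z = k z * g z) (z : ℂ) :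
    f z = g z := by
  have hev : f =ᶠ[𝓝 z₀] g := by
    filter_upwards [hk.continuous.continuousAt.eventually_ne hz₀] with z hz
    exact mul_left_cancel₀ hz (h z)
  exact congrFun (AnalyticOnNhd.eq_of_eventuallyEq (fun z _ => hf.analyticAt z)
    (fun z _ => hg.analyticAt z) hev) z

/-- The multipliers of the quotient of two theta functions of the same degree. -/
lemma IsTheta.quotient {τ : ℂ} {N : ℕ} {s t : ℂ} {f g h : ℂ → ℂ} (hf : IsTheta τ N s f)
    (hg : IsTheta τ N t g) (hh : Differentiable ℂ h) (hfg : ∀ z, f z = h z * g z) {z₀ : ℂ}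
    (hz₀ : g z₀ ≠ 0) :
    (∀ z, h (z + 1) = h z) ∧ ∀ z, h (z + τ) = cexp (2 * Real.pi * I * (s - t)) * h z := by
  have h5 : ((-1 : ℂ) ^ N) * (-1) ^ N = 1 := by rw [← mul_pow]; simp
  constructor
  · refine mul_left_cancel_entire (hh.comp (by fun_prop : Differentiable ℂ fun z : ℂ => z + 1)) hh
      hg.differentiable hz₀ fun z => ?_
    have e := hf.add_one z
    rw [hfg, hfg, hg.add_one] at e
    change g z * h (z + 1) = _
    linear_combination (-1) ^ N * e - (h (z + 1) * g z - h z * g z) * h5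
  · refine mul_left_cancel_entire (hh.comp (by fun_prop : Differentiable ℂ fun z : ℂ => z + τ))
      (hh.const_mul _) hg.differentiable hz₀ fun z => ?_
    have e := hf.add_tau z
    rw [hfg, hfg, hg.add_tau, show -(Real.pi * I * N * τ) - 2 * Real.pi * I * (N * z - s) =
      (-(Real.pi * I * N * τ) - 2 * Real.pi * I * (N * z - t)) + 2 * Real.pi * I * (s - t) by ring,
      Complex.exp_add] at e
    change g z * h (z + τ) = _
    refine mul_left_cancel₀ (mul_ne_zero (pow_ne_zero N (neg_ne_zero.mpr one_ne_zero))
      (Complex.exp_ne_zero (-(Real.pi * I * N * τ) - 2 * Real.pi * I * (N * z - t)))) ?_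
    linear_combination e

/-- Up to a constant, `θ` is given by its product formula: the quotient of both sides is entire
and doubly periodic. -/
lemma theta_eq_const_mul_thetaProd {τ : ℂ} (hτ : 0 < τ.im) :
    ∃ C : ℂ, C ≠ 0 ∧ ∀ z, theta τ z = C * thetaProd τ z := by
  have hθ := isTheta_theta hτ
  have hQ := isTheta_thetaProd hτ
  obtain ⟨h, hd, hfac⟩ := exists_differentiable_eq_mul hθ.differentiable hQ.differentiable
    (fun z hz => deriv_thetaProd_ne_zero hτ hz) (fun z hz => by
      obtain ⟨a, b, rfl⟩ := exists_int_of_thetaProd_eq_zero hτ hz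
      exact theta_lattice hτ a b)
  obtain ⟨z₀, hz₀⟩ := exists_theta_ne_zero hτ
  have hQ₀ : thetaProd τ z₀ ≠ 0 := fun h0 => hz₀ (by rw [hfac, h0, mul_zero])
  obtain ⟨h1, h2⟩ := hθ.quotient hQ hd hfac hQ₀
  obtain ⟨C, hC⟩ := exists_eq_const_mul_exp hτ hd 0 h1 (by simpa using h2)
  have hC' : ∀ z, theta τ z = C * thetaProd τ z := fun z => by
    rw [hfac, hC]; simp
  refine ⟨C, fun h0 => hz₀ (by rw [hC', h0, zero_mul]), hC'⟩

/-- The zeros of `θ` are lattice points. -/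
lemma exists_int_of_theta_eq_zero {τ z : ℂ} (hτ : 0 < τ.im) (h : theta τ z = 0) :
    ∃ a b : ℤ, z = a + b * τ := by
  obtain ⟨C, hC, hθ⟩ := theta_eq_const_mul_thetaProd hτ
  rw [hθ] at h
  exact exists_int_of_thetaProd_eq_zero hτ ((mul_eq_zero.mp h).resolve_left hC)

/-- The zeros of `θ` are simple. -/
lemma deriv_theta_ne_zero {τ z : ℂ} (hτ : 0 < τ.im) (h : theta τ z = 0) :
    deriv (theta τ) z ≠ 0 := by
  obtain ⟨C, hC, hθ⟩ := theta_eq_const_mul_thetaProd hτ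
  have h0 : thetaProd τ z = 0 := by
    rw [hθ] at h
    exact (mul_eq_zero.mp h).resolve_left hC
  rw [show theta τ = fun z => C * thetaProd τ z from funext hθ, deriv_const_mul_field]
  exact mul_ne_zero hC (deriv_thetaProd_ne_zero hτ h0)

/-- The zero set of a theta function is invariant under the lattice; the congruence of the two
points is expressed by `θ(z - a) = 0`. -/
lemma IsTheta.eq_zero_of_theta_sub_eq_zero {τ : ℂ} (hτ : 0 < τ.im) {N : ℕ} {s : ℂ} {f : ℂ → ℂ}
    (hf : IsTheta τ N s f) {z a : ℂ} (ha : f a = 0) (hz : theta τ (z - a) = 0) : f z = 0 := by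
  obtain ⟨k, m, hkm⟩ := exists_int_of_theta_eq_zero hτ hz
  rw [← add_sub_cancel a z, hkm]
  exact hf.eq_zero_add_lattice ha k m

/-! ### Operations on theta functions -/

namespace IsTheta

variable {τ s t : ℂ} {N M : ℕ} {f g : ℂ → ℂ}

lemma mul (hf : IsTheta τ N s f) (hg : IsTheta τ M t g) :
    IsTheta τ (N + M) (s + t) fun z => f z * g z where
  differentiable := hf.differentiable.mul hg.differentiable
  add_one z := by rw [hf.add_one, hg.add_one]; ring
  add_tau z := by
    have : -(Real.pi * I * (N + M : ℕ) * τ) - 2 * Real.pi * I * ((N + M : ℕ) * z - (s + t)) =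
        (-(Real.pi * I * N * τ) - 2 * Real.pi * I * (N * z - s)) +
        (-(Real.pi * I * M * τ) - 2 * Real.pi * I * (M * z - t)) := by push_cast; ring
    rw [this, Complex.exp_add, hf.add_tau, hg.add_tau]
    ring

lemma const_mul (hf : IsTheta τ N s f) (c : ℂ) : IsTheta τ N s fun z => c * f z where
  differentiable := hf.differentiable.const_mul c
  add_one z := by rw [hf.add_one]; ring
  add_tau z := by rw [hf.add_tau]; ring

lemma sub (hf : IsTheta τ N s f) (hg : IsTheta τ N s g) : IsTheta τ N s fun z => f z - g z where
  differentiable := hf.differentiable.sub hg.differentiable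
  add_one z := by rw [hf.add_one, hg.add_one]; ring
  add_tau z := by rw [hf.add_tau, hg.add_tau]; ring

lemma sum {ι : Type*} {F : ι → ℂ → ℂ} (S : Finset ι) (h : ∀ i ∈ S, IsTheta τ N s (F i)) :
    IsTheta τ N s fun z => ∑ i ∈ S, F i z where
  differentiable := Differentiable.fun_sum fun i hi => (h i hi).differentiable
  add_one z := by
    rw [Finset.mul_sum]
    exact Finset.sum_congr rfl fun i hi => (h i hi).add_one z
  add_tau z := by
    rw [Finset.mul_sum]
    exact Finset.sum_congr rfl fun i hi => (h i hi).add_tau z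

lemma comp_sub_const (hf : IsTheta τ N s f) (a : ℂ) :
    IsTheta τ N (s + N * a) fun z => f (z - a) where
  differentiable := hf.differentiable.comp (by fun_prop)
  add_one z := by rw [← hf.add_one]; ring_nf
  add_tau z := by
    rw [show -(Real.pi * I * N * τ) - 2 * Real.pi * I * (N * z - (s + N * a)) =
      -(Real.pi * I * N * τ) - 2 * Real.pi * I * (N * (z - a) - s) by ring, ← hf.add_tau]
    ring_nf

lemma comp_const_sub (hf : IsTheta τ N s f) (K : ℂ) :
    IsTheta τ N (N * K - s) fun z => f (K - z) where
  differentiable := hf.differentiable.comp (by fun_prop)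
  add_one z := by
    have h := hf.add_one (K - (z + 1))
    have h5 : ((-1 : ℂ) ^ N) * (-1) ^ N = 1 := by rw [← mul_pow]; simp
    rw [show K - (z + 1) + 1 = K - z by ring] at h
    linear_combination -(-1) ^ N * h - f (K - (z + 1)) * h5
  add_tau z := by
    have h := hf.add_tau (K - (z + τ))
    have h5 : ((-1 : ℂ) ^ N) * (-1) ^ N = 1 := by rw [← mul_pow]; simp
    rw [show K - (z + τ) + τ = K - z by ring] at h
    have h4 : cexp (-(Real.pi * I * N * τ) - 2 * Real.pi * I * (N * z - (N * K - s))) *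
        cexp (-(Real.pi * I * N * τ) - 2 * Real.pi * I * (N * (K - (z + τ)) - s)) = 1 := by
      rw [← Complex.exp_add, Complex.exp_eq_one_iff]
      exact ⟨0, by push_cast; ring⟩
    rw [h]
    linear_combination -(f (K - (z + τ))) * h4 - f (K - (z + τ)) *
      cexp (-(Real.pi * I * N * τ) - 2 * Real.pi * I * (N * z - (N * K - s))) *
        cexp (-(Real.pi * I * N * τ) - 2 * Real.pi * I * (N * (K - (z + τ)) - s)) * h5

lemma of_eq (hf : IsTheta τ N s f) {N' : ℕ} {s' : ℂ} (hN : N = N') (hs : s = s') :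
    IsTheta τ N' s' f := hN ▸ hs ▸ hf

end IsTheta

lemma isTheta_theta_sub {τ : ℂ} (hτ : 0 < τ.im) (a : ℂ) : IsTheta τ 1 a fun z => theta τ (z - a) :=
  ((isTheta_theta hτ).comp_sub_const a).of_eq rfl (by simp)

lemma isTheta_prod {τ : ℂ} (hτ : 0 < τ.im) {ι : Type*} (S : Finset ι) (a : ι → ℂ) :
    IsTheta τ S.card (∑ i ∈ S, a i) fun z => ∏ i ∈ S, theta τ (z - a i) := by
  classical
  induction S using Finset.induction_on with
  | empty => exact ⟨by simp, by simp, by simp⟩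
  | insert i S hi ih =>
    simp only [Finset.prod_insert hi, Finset.sum_insert hi, Finset.card_insert_of_notMem hi]
    exact ((isTheta_theta_sub hτ (a i)).mul ih).of_eq (add_comm _ _) rfl

lemma isTheta_thetaIdx {n : ℕ} (hn : 0 < n) {τ : ℂ} (hτ : 0 < τ.im) (j : Fin n) :
    IsTheta τ n 0 (thetaIdx n τ j) where
  differentiable := differentiable_thetaIdx hn hτ j
  add_one := thetaIdx_add_one hn τ j
  add_tau z := by rw [thetaIdx_add_tau, sub_zero]

/-! ### Interpolation by theta functions -/

lemma theta_sub_eq_zero {τ a b : ℂ} (hτ : 0 < τ.im) (ha : theta τ a = 0) (hb : theta τ b = 0) :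
    theta τ (a - b) = 0 :=
  (isTheta_theta hτ).eq_zero_of_theta_sub_eq_zero hτ (a := -b) (by simp [hb]) (by simpa using ha)

lemma eventually_theta_ne_zero {τ : ℂ} (hτ : 0 < τ.im) (c x : ℂ) :
    ∀ᶠ z in 𝓝[≠] x, theta τ (z - c) ≠ 0 := by
  have hd := (isTheta_theta_sub hτ c).differentiable
  by_cases h : theta τ (x - c) = 0
  · have h1 : HasDerivAt (fun z => theta τ (z - c)) (deriv (theta τ) (x - c)) x :=
      (differentiable_theta hτ (x - c)).hasDerivAt.comp_sub_const x c
    exact h1.eventually_ne (deriv_theta_ne_zero hτ h)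
  · exact (hd.continuous.continuousAt.eventually_ne h).filter_mono nhdsWithin_le_nhds

lemma exists_forall_theta_ne_zero {τ : ℂ} (hτ : 0 < τ.im) {ι : Type*} [Finite ι] (a : ι → ℂ) :
    ∃ z, ∀ i, theta τ (z - a i) ≠ 0 :=
  (eventually_all.mpr fun i => eventually_theta_ne_zero hτ (a i) 0).exists

/-- The zeros of `∏ θ(z - p_i)` are simple, since no two factors vanish at the same point. -/
lemma deriv_prod_theta_ne_zero {τ : ℂ} (hτ : 0 < τ.im) {ι : Type*} [Fintype ι] {p : ι → ℂ}
    (hp : ∀ i j, i ≠ j → theta τ (p i - p j) ≠ 0) {z : ℂ}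
    (hz : ∏ i, theta τ (z - p i) = 0) : deriv (fun z => ∏ i, theta τ (z - p i)) z ≠ 0 := by
  classical
  obtain ⟨k, -, hk⟩ := Finset.prod_eq_zero_iff.mp hz
  have hne : ∀ l, l ≠ k → theta τ (z - p l) ≠ 0 := fun l hl h0 => by
    refine hp l k hl ?_
    have := theta_sub_eq_zero hτ hk h0
    rwa [sub_sub_sub_cancel_left] at this
  have hd := HasDerivAt.fun_finsetProd (u := Finset.univ) (x := z)
    (f := fun i z => theta τ (z - p i)) (f' := fun i => deriv (theta τ) (z - p i))
    fun i _ => (differentiable_theta hτ (z - p i)).hasDerivAt.comp_sub_const z (p i)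
  rw [hd.deriv, Finset.sum_eq_single k]
  · refine mul_ne_zero (Finset.prod_ne_zero_iff.mpr fun l hl => ?_) ?_
    · exact hne l (Finset.ne_of_mem_erase hl)
    · exact deriv_theta_ne_zero hτ hk
  · intro l _ hl
    rw [Finset.prod_eq_zero (Finset.mem_erase.mpr ⟨hl.symm, Finset.mem_univ k⟩) hk, zero_smul]
  · simp

/-- A theta function of degree `N` that vanishes at `N` points, distinct modulo the lattice, is
zero, unless the sum of the points is its characteristic modulo the lattice. -/
lemma IsTheta.eq_zero_of_forall {τ : ℂ} (hτ : 0 < τ.im) {ι : Type*} [Fintype ι] {s : ℂ}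
    {f : ℂ → ℂ} (hf : IsTheta τ (Fintype.card ι) s f) {p : ι → ℂ}
    (hp : ∀ i j, i ≠ j → theta τ (p i - p j) ≠ 0) (hw : theta τ (∑ i, p i - s) ≠ 0)
    (h0 : ∀ i, f (p i) = 0) (z : ℂ) : f z = 0 := by
  have hG : IsTheta τ (Fintype.card ι) (∑ i, p i) fun z => ∏ i, theta τ (z - p i) :=
    isTheta_prod hτ Finset.univ p
  obtain ⟨h, hd, hfac⟩ := exists_differentiable_eq_mul hf.differentiable hG.differentiable
    (fun z hz => deriv_prod_theta_ne_zero hτ hp hz) (fun z hz => by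
      obtain ⟨k, -, hk⟩ := Finset.prod_eq_zero_iff.mp hz
      exact hf.eq_zero_of_theta_sub_eq_zero hτ (h0 k) hk)
  obtain ⟨z₀, hz₀⟩ := exists_forall_theta_ne_zero hτ p
  obtain ⟨h1, h2⟩ := hf.quotient hG hd hfac (z₀ := z₀)
    (Finset.prod_ne_zero_iff.mpr fun i _ => hz₀ i)
  obtain ⟨C, hC⟩ := exists_eq_const_mul_exp hτ hd _ h1 h2
  -- If `C ≠ 0`, comparing multipliers shows that `∑ p_i - s` is a lattice point.
  suffices hC0 : C = 0 by rw [hfac, hC, hC0, zero_mul, zero_mul]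
  by_contra hC0
  apply hw
  have e1 := h1 0
  have e2 := h2 0
  rw [hC, hC 0, mul_zero, Complex.exp_zero] at e1 e2
  have h2π : (2 * Real.pi * I : ℂ) ≠ 0 := by simp [Real.pi_ne_zero]
  obtain ⟨m, hm⟩ := Complex.exp_eq_one_iff.mp (mul_left_cancel₀ hC0 e1)
  obtain ⟨k, hk⟩ := Complex.exp_eq_exp_iff_exists_int.mp
    (mul_left_cancel₀ hC0 (e2.trans (by ring) : _ = C * cexp (2 * Real.pi * I * (s - ∑ i, p i))))
  rw [show ∑ i, p i - s = (k : ℤ) + (-m : ℤ) * τ from ?_]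
  · exact theta_lattice hτ k (-m)
  · apply mul_left_cancel₀ h2π
    push_cast
    linear_combination hk - τ * hm

/-- Lagrange interpolation for theta functions of degree `N` at `N` points. -/
lemma IsTheta.interpolation {τ : ℂ} (hτ : 0 < τ.im) {ι : Type*} [Fintype ι] [DecidableEq ι] {s : ℂ}
    {f : ℂ → ℂ} (hf : IsTheta τ (Fintype.card ι) s f) {p : ι → ℂ}
    (hp : ∀ i j, i ≠ j → theta τ (p i - p j) ≠ 0) {w : ℂ} (hw : theta τ w ≠ 0)
    (hsum : ∑ i, p i = w + s) (z : ℂ) :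
    f z = ∑ k, f (p k) * (theta τ (z - p k + w) / theta τ w *
      ∏ l ∈ Finset.univ.erase k, theta τ (z - p l) / theta τ (p k - p l)) := by
  have hl : ∀ k, IsTheta τ (Fintype.card ι) s fun z => f (p k) *
      (theta τ (z - p k + w) / theta τ w *
        ∏ l ∈ Finset.univ.erase k, theta τ (z - p l) / theta τ (p k - p l)) := by
    intro k
    have hs : p k - w + ∑ l ∈ Finset.univ.erase k, p l = s := by
      rw [← Finset.add_sum_erase _ _ (Finset.mem_univ k)] at hsum
      linear_combination hsum
    have hcard : 1 + (Finset.univ.erase k).card = Fintype.card ι := by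
      rw [add_comm, Finset.card_erase_add_one (Finset.mem_univ k), Finset.card_univ]
    have h := (((isTheta_theta_sub hτ (p k - w)).mul
      (isTheta_prod hτ (Finset.univ.erase k) p)).of_eq hcard hs).const_mul
      (f (p k) / (theta τ w * ∏ l ∈ Finset.univ.erase k, theta τ (p k - p l)))
    convert h using 2 with z
    rw [Finset.prod_div_distrib, show z - (p k - w) = z - p k + w by ring]
    ring
  refine sub_eq_zero.mp ((hf.sub (IsTheta.sum Finset.univ fun k _ => hl k)).eq_zero_of_forall hτ hp
    (by rwa [hsum, add_sub_cancel_right]) (fun i => ?_) z)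
  rw [Finset.sum_eq_single i, sub_eq_zero]
  · rw [Finset.prod_eq_one, sub_self, zero_add, div_self hw]
    · ring
    · intro l hl
      exact div_self (hp i l (Finset.ne_of_mem_erase hl).symm)
  · intro k _ hk
    rw [Finset.prod_eq_zero (Finset.mem_erase.mpr ⟨hk.symm, Finset.mem_univ i⟩)]
    · ring
    · simp
  · simp

/-- The residue theorem for the elliptic function `g / ∏ θ(z - a_l)`. It is obtained from the
interpolation formula by replacing one of the points with a generic one and evaluating at the
point that was removed. -/
lemma IsTheta.sum_residues {τ : ℂ} (hτ : 0 < τ.im) {ι : Type*} [Fintype ι] [DecidableEq ι] {s : ℂ}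
    {g : ℂ → ℂ} {a : ι → ℂ} (hg : IsTheta τ (Fintype.card ι) s g) (hs : s = ∑ i, a i)
    (ha : ∀ i j, i ≠ j → theta τ (a i - a j) ≠ 0) :
    ∑ k, g (a k) / ∏ l ∈ Finset.univ.erase k, theta τ (a k - a l) = 0 := by
  cases isEmpty_or_nonempty ι with
  | inl h => simp
  | inr h =>
  obtain ⟨k₀⟩ := h
  obtain ⟨b, hb⟩ := exists_forall_theta_ne_zero hτ a
  set p := Function.update a k₀ b with hpdef
  have hpk : p k₀ = b := Function.update_self _ _ _
  have hpl : ∀ l, l ≠ k₀ → p l = a l := fun l hl => Function.update_of_ne hl _ _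
  have hp : ∀ i j, i ≠ j → theta τ (p i - p j) ≠ 0 := by
    intro i j hij
    by_cases hi : i = k₀
    · subst hi
      rw [hpk, hpl j hij.symm]
      exact hb j
    · by_cases hj : j = k₀
      · subst hj
        rw [hpk, hpl i hi, theta_sub_comm]
        exact neg_ne_zero.mpr (hb i)
      · rw [hpl i hi, hpl j hj]
        exact ha i j hij
  have hsum : ∑ i, p i = (b - a k₀) + s := by
    rw [hs, ← Finset.add_sum_erase _ _ (Finset.mem_univ k₀),
      ← Finset.add_sum_erase _ a (Finset.mem_univ k₀), hpk,
      Finset.sum_congr rfl fun l hl => hpl l (Finset.ne_of_mem_erase hl)]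
    ring
  have key := hg.interpolation hτ hp (hb k₀) hsum (a k₀)
  have hD : ∏ l ∈ Finset.univ.erase k₀, theta τ (a k₀ - a l) ≠ 0 :=
    Finset.prod_ne_zero_iff.mpr fun l hl => ha _ _ (Finset.ne_of_mem_erase hl).symm
  -- The coefficient of `g b` contains the factor `θ(0) = 0`.
  rw [← Finset.add_sum_erase _ _ (Finset.mem_univ k₀), hpk,
    show a k₀ - b + (b - a k₀) = 0 by ring, theta_zero, zero_div, zero_mul, mul_zero,
    zero_add] at key
  rw [← Finset.add_sum_erase _ _ (Finset.mem_univ k₀)]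
  nth_rewrite 1 [key]
  rw [Finset.sum_div, ← Finset.sum_add_distrib]
  refine Finset.sum_eq_zero fun k hk => ?_
  -- In the remaining terms `b` cancels, since `a k₀ - a k + (b - a k₀) = b - a k`.
  have hkk : k ≠ k₀ := Finset.ne_of_mem_erase hk
  have hk0 : k₀ ∈ Finset.univ.erase k := Finset.mem_erase.mpr ⟨hkk.symm, Finset.mem_univ _⟩
  have hk1 : k ∈ Finset.univ.erase k₀ := hk
  rw [hpl k hkk, ← Finset.mul_prod_erase _ _ hk0, hpk,
    ← Finset.mul_prod_erase _ (fun l => theta τ (a k - a l)) hk0,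
    ← Finset.mul_prod_erase _ (fun l => theta τ (a k₀ - a l)) hk1, Finset.erase_right_comm,
    Finset.prod_congr rfl (g := fun l => theta τ (a k₀ - a l) / theta τ (a k - a l))
      (fun l hl => by rw [hpl l (Finset.ne_of_mem_erase (Finset.mem_of_mem_erase hl))]),
    Finset.prod_div_distrib]
  have hA : ∏ l ∈ (Finset.univ.erase k₀).erase k, theta τ (a k₀ - a l) ≠ 0 :=
    Finset.prod_ne_zero_iff.mpr fun l hl =>
      ha _ _ (Finset.ne_of_mem_erase (Finset.mem_of_mem_erase hl)).symm
  have hB : ∏ l ∈ (Finset.univ.erase k₀).erase k, theta τ (a k - a l) ≠ 0 :=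
    Finset.prod_ne_zero_iff.mpr fun l hl => ha _ _ (Finset.ne_of_mem_erase hl).symm
  rw [show a k₀ - a k + (b - a k₀) = b - a k by ring, theta_sub_comm τ (a k) b,
    theta_sub_comm τ (a k₀) b, theta_sub_comm τ (a k) (a k₀)]
  have h1 := hb k
  have h2 := hb k₀
  have h3 := ha k₀ k hkk.symm
  field_simp
  ring

/-! ### Intertwining vectors -/

/-- A linear relation between the rows of `φ_x(w)` gives a linear combination of the `θ_i` that
vanishes at `n` points with sum `w`, hence everywhere. -/
lemma isUnit_phi {n : ℕ} (hn : 0 < n) {τ : ℂ} (hτ : 0 < τ.im) {x : Fin n → ℂ}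
    (hx : ∀ i j, i ≠ j → theta τ (x i - x j) ≠ 0) {w : ℂ} (hw : theta τ w ≠ 0) :
    IsUnit (phi τ x w) := by
  have hn' : (n : ℂ) ≠ 0 := by exact_mod_cast hn.ne'
  have hη : I * ModularForm.eta τ ≠ 0 := mul_ne_zero I_ne_zero (ModularForm.eta_ne_zero hτ)
  rw [← Matrix.vecMul_injective_iff_isUnit]
  refine (injective_iff_map_eq_zero (Matrix.vecMulLinear (phi τ x w))).mpr fun v hv => ?_
  have hf : IsTheta τ (Fintype.card (Fin n)) 0 fun z => ∑ i, v i * thetaIdx n τ i z := by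
    rw [Fintype.card_fin]
    exact IsTheta.sum _ fun i _ => (isTheta_thetaIdx hn hτ i).const_mul _
  have h0 := hf.eq_zero_of_forall hτ (p := fun k => w / n - barCoord x k)
    (fun i j hij => by
      simp only [barCoord]
      convert hx j i hij.symm using 2
      ring)
    (by
      simp only [barCoord, Finset.sum_sub_distrib, Finset.sum_const, Finset.card_univ,
        Fintype.card_fin, nsmul_eq_mul, mul_div_cancel₀ _ hn']
      simpa using hw)
    (fun k => by
      have := congrFun hv k
      simp only [Matrix.vecMulLinear_apply, Matrix.vecMul, dotProduct, phi, Matrix.of_apply,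
        Pi.zero_apply] at this
      rw [← mul_left_inj' (inv_ne_zero hη), zero_mul, Finset.sum_mul, ← this]
      exact Finset.sum_congr rfl fun i _ => by rw [mul_assoc, ← div_eq_mul_inv])
  exact funext fun i => Fintype.linearIndependent_iff.mp (linearIndependent_thetaIdx hn hτ) v
    (funext fun z => by simpa [Finset.sum_apply] using h0 z) i

/-- The rows of the explicit matrix consist of the Lagrange coefficients for the points `-x_k`. -/
lemma IsTheta.sum_explicitMatrix_mul {n : ℕ} {τ : ℂ} (hτ : 0 < τ.im) {η w s : ℂ}
    {x : Fin n → ℂ} (y a : Fin n → ℂ) (hx : ∀ i j, i ≠ j → theta τ (x i - x j) ≠ 0)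
    (hw : theta τ w ≠ 0) {f : ℂ → ℂ} (hf : IsTheta τ n s f) (hs : w + s = -∑ k, x k) (k' : Fin n) :
    ∑ k, explicitMatrix τ η y x w a k' k * f (-x k) = a k' * f (η / n - y k') := by
  rw [(hf.of_eq (Fintype.card_fin n).symm rfl).interpolation hτ (p := fun k => -x k)
    (fun i j hij => by rw [neg_sub_neg]; exact hx j i hij.symm) hw
    (by rw [Finset.sum_neg_distrib, hs]), Finset.mul_sum]
  refine Finset.sum_congr rfl fun k _ => ?_
  simp only [explicitMatrix, Matrix.of_apply]
  rw [show η / n - y k' - -x k + w = w + x k - y k' + η / n by ring,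
    Finset.prod_congr rfl fun l _ => by
      rw [show x l - y k' + η / n = η / n - y k' - -x l by ring,
        show x l - x k = -x k - -x l by ring]]
  ring

/-- The change of basis between two families of intertwining vectors is the explicit matrix. -/
lemma phi_mul_explicitMatrix {n : ℕ} (hn : 0 < n) {τ : ℂ} (hτ : 0 < τ.im) {η w z : ℂ}
    {x y : Fin n → ℂ} (a : Fin n → ℂ) (hx : ∀ i j, i ≠ j → theta τ (x i - x j) ≠ 0)
    (hw : theta τ w ≠ 0) (hz : z + ∑ k, y k = w + η + ∑ k, x k) :
    phi τ x w * (explicitMatrix τ η y x w a)ᵀ = phi τ y z * Matrix.diagonal a := by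
  have hn' : (n : ℂ) ≠ 0 := by exact_mod_cast hn.ne'
  ext i k'
  obtain ⟨A, hA⟩ : ∃ A, A = w / n + (∑ k, x k) / n := ⟨_, rfl⟩
  have hnA : n * A = w + ∑ k, x k := by
    rw [hA, mul_add, mul_div_cancel₀ _ hn', mul_div_cancel₀ _ hn']
  have h := ((isTheta_thetaIdx hn hτ i).comp_sub_const (-A)).sum_explicitMatrix_mul hτ (η := η)
    (w := w) y a hx hw (by linear_combination -hnA) k'
  have hx' : ∀ k, w / n - (x k - (∑ l, x l) / n) = -x k - -A := fun k => by rw [hA]; ring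
  have hy' : z / n - (y k' - (∑ l, y l) / n) = η / n - y k' - -A := by
    rw [hA]; field_simp; linear_combination hz
  rw [Matrix.mul_diagonal, Matrix.mul_apply]
  simp only [phi, Matrix.of_apply, Matrix.transpose_apply, barCoord, hx', hy']
  rw [div_mul_eq_mul_div, mul_comm _ (a k'), ← h, Finset.sum_div]
  exact Finset.sum_congr rfl fun k _ => by ring

/-- The common shape of `LOp` and `MOp`. -/
lemma of_sum_eq_mul {n : ℕ} (A B : Matrix (Fin n) (Fin n) ℂ) (a : Fin n → ℂ) :
    Matrix.of (fun j i => ∑ k, A k j * B i k * a k) = Aᵀ * Matrix.diagonal a * Bᵀ := by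
  ext j i
  rw [Matrix.mul_apply]
  simp only [Matrix.of_apply, Matrix.mul_diagonal, Matrix.transpose_apply]
  exact Finset.sum_congr rfl fun k _ => by ring

lemma LOp_eq_mul {n : ℕ} (τ η v : ℂ) (x t : Fin n → ℂ) (z : ℂ) :
    LOp τ η v x t z = (phiBar τ x (z - v - η))ᵀ * Matrix.diagonal t * (phi τ x (z - v))ᵀ :=
  of_sum_eq_mul _ _ _

lemma MOp_eq_mul {n : ℕ} (τ η u v : ℂ) (mu C : Fin n → ℂ) (z : ℂ) :
    MOp τ η u v mu C z = (phiBar τ mu (z - v - η))ᵀ * Matrix.diagonal C * (phi τ mu (z - u))ᵀ :=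
  of_sum_eq_mul _ _ _

lemma degZero_eq_mul {n : ℕ} (τ : ℂ) (y x : Fin n → ℂ) (w : ℂ) (A : Matrix (Fin n) (Fin n) ℂ) :
    degZero τ y x w A = (phi τ y w)ᵀ * A * (phiBar τ x w)ᵀ := by
  ext k' k
  simp only [degZero, Matrix.of_apply, Matrix.mul_apply, Matrix.transpose_apply, Finset.sum_mul]
  exact Finset.sum_congr rfl fun i _ => Finset.sum_congr rfl fun j _ => by ring

/-- The explicit matrix in terms of intertwining vectors. -/
lemma explicitMatrix_eq_mul {n : ℕ} (hn : 0 < n) {τ : ℂ} (hτ : 0 < τ.im) {η w z : ℂ}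
    {x y : Fin n → ℂ} (a : Fin n → ℂ) (hx : ∀ i j, i ≠ j → theta τ (x i - x j) ≠ 0)
    (hw : theta τ w ≠ 0) (hz : z + ∑ k, y k = w + η + ∑ k, x k) :
    explicitMatrix τ η y x w a = Matrix.diagonal a * (phi τ y z)ᵀ * (phiBar τ x w)ᵀ := by
  have h := phi_mul_explicitMatrix hn hτ a hx hw hz
  have hu := (Matrix.isUnit_iff_isUnit_det _).mp (isUnit_phi hn hτ hx hw)
  rw [← Matrix.transpose_inj, phiBar, Matrix.mul_assoc, ← Matrix.transpose_mul,
    Matrix.transpose_mul, Matrix.transpose_transpose, Matrix.diagonal_transpose, Matrix.mul_assoc,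
    ← h, Matrix.nonsing_inv_mul_cancel_left _ _ hu]

/-- The degree-zero gauge form of an operator that is built from intertwining vectors. -/
lemma degZero_eq_explicitMatrix {n : ℕ} (hn : 0 < n) {τ : ℂ} (hτ : 0 < τ.im) {η w z : ℂ}
    {x y : Fin n → ℂ} (a : Fin n → ℂ) (hx : ∀ i j, i ≠ j → theta τ (x i - x j) ≠ 0)
    (hy : ∀ i j, i ≠ j → theta τ (y i - y j) ≠ 0)
    (hw : theta τ w ≠ 0) (hz : z + ∑ k, y k = w + η + ∑ k, x k) :
    degZero τ y x w ((phiBar τ y w)ᵀ * Matrix.diagonal a * (phi τ y z)ᵀ) =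
      explicitMatrix τ η y x w a := by
  have hu := (Matrix.isUnit_iff_isUnit_det _).mp (isUnit_phi hn hτ hy hw)
  have h1 : (phi τ y w)ᵀ * (phiBar τ y w)ᵀ = 1 := by
    rw [← Matrix.transpose_mul, phiBar, Matrix.nonsing_inv_mul _ hu, Matrix.transpose_one]
  rw [degZero_eq_mul, explicitMatrix_eq_mul hn hτ a hx hw hz]
  simp only [← Matrix.mul_assoc]
  rw [h1, Matrix.one_mul]

/-! ### The discrete Lax equation -/

lemma prod_theta_sub_swap {n : ℕ} (τ : ℂ) (a : Fin n → ℂ) (k : Fin n) :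
    ∏ l ∈ Finset.univ.erase k, theta τ (a l - a k) =
      (-1) ^ (n - 1) * ∏ l ∈ Finset.univ.erase k, theta τ (a k - a l) := by
  rw [Finset.prod_congr rfl fun l _ => theta_sub_comm τ (a l) (a k), Finset.prod_neg,
    Finset.card_erase_of_mem (Finset.mem_univ k), Finset.card_fin]

/-- The numbers `C_k e^c` and `t̃_k` differ by the ratio of products that makes the residues of the
two sides of the Lax equation opposite to each other. -/
lemma CCoeff_mul_exp {n : ℕ} {τ η c : ℂ} {lam mu : Fin n → ℂ}
    (hmuη : ∀ i j, i ≠ j → theta τ (mu i - mu j + η / (n : ℂ)) ≠ 0) (k : Fin n) :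
    CCoeff τ η lam mu k * Complex.exp c * ∏ l, theta τ (lam l - mu k + η / n) =
      -(tTildeCoeff τ η c lam mu k * ∏ l, theta τ (mu l - mu k + η / n)) := by
  have hP : ∏ m ∈ Finset.univ.erase k, theta τ (mu m - mu k + η / n) ≠ 0 :=
    Finset.prod_ne_zero_iff.mpr fun m hm => hmuη _ _ (Finset.ne_of_mem_erase hm)
  rw [CCoeff, tTildeCoeff, Finset.prod_div_distrib, Finset.prod_div_distrib,
    Finset.prod_div_distrib,
    ← Finset.mul_prod_erase _ (fun m => theta τ (mu m - mu k - η / n)) (Finset.mem_univ k),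
    ← Finset.mul_prod_erase _ (fun m => theta τ (mu m - mu k + η / n)) (Finset.mem_univ k),
    sub_self, zero_sub, zero_add, theta_neg]
  field_simp

/-- The Lax equation, evaluated on a theta function. Both sides are sums of residues of one
elliptic function, the left-hand side at the points `λ_k` and the right-hand side at `μ_k`. -/
lemma IsTheta.lax_identity {n : ℕ} {τ : ℂ} (hτ : 0 < τ.im) {η c w s K : ℂ}
    {lam mu : Fin n → ℂ} (hlam : ∀ i j, i ≠ j → theta τ (lam i - lam j) ≠ 0)
    (hmu : ∀ i j, i ≠ j → theta τ (mu i - mu j) ≠ 0)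
    (hlammu : ∀ i j, theta τ (lam i - mu j) ≠ 0)
    (hmuη : ∀ i j, i ≠ j → theta τ (mu i - mu j + η / (n : ℂ)) ≠ 0)
    {f : ℂ → ℂ} (hf : IsTheta τ n s f) (hK : n * K - s = w + η + ∑ k, lam k) (k' : Fin n) :
    ∑ k, explicitMatrix τ η mu lam w (CCoeff τ η lam mu) k' k * tCoeff τ η c lam mu k *
        f (K - lam k) =
      ∑ k, explicitMatrix τ η mu mu w (tTildeCoeff τ η c lam mu) k' k * CCoeff τ η lam mu k *
        f (K - mu k) := by
  have hn : 0 < n := k'.pos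
  have hn' : (n : ℂ) ≠ 0 := by exact_mod_cast hn.ne'
  set δ := η / (n : ℂ) with hδ
  have hg := (hf.comp_const_sub K).mul ((isTheta_theta_sub hτ (mu k' - δ - w)).mul
    (isTheta_prod hτ (Finset.univ.erase k') fun l => mu l - δ))
  -- The elliptic function in question is `g(z) / ∏ θ(z - λ_l) θ(z - μ_l)`.
  set g : ℂ → ℂ := fun z => f (K - z) * (theta τ (z - (mu k' - δ - w)) *
    ∏ l ∈ Finset.univ.erase k', theta τ (z - (mu l - δ))) with hgdef
  have hcard : n + (1 + (Finset.univ.erase k').card) = Fintype.card (Fin n ⊕ Fin n) := by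
    rw [Finset.card_erase_of_mem (Finset.mem_univ k'), Finset.card_fin, Fintype.card_sum,
      Fintype.card_fin]
    omega
  have hsum : n * K - s + (mu k' - δ - w + ∑ l ∈ Finset.univ.erase k', (mu l - δ)) =
      ∑ i, Sum.elim lam mu i := by
    have h1 : mu k' - δ + ∑ l ∈ Finset.univ.erase k', (mu l - δ) = ∑ l, mu l - η := by
      rw [Finset.add_sum_erase _ (fun l => mu l - δ) (Finset.mem_univ k'),
        Finset.sum_sub_distrib, Finset.sum_const, Finset.card_fin, nsmul_eq_mul, hδ,
        mul_div_cancel₀ _ hn']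
    rw [Fintype.sum_sum_type]
    simp only [Sum.elim_inl, Sum.elim_inr]
    linear_combination hK + h1
  have hres := hg.of_eq hcard rfl |>.sum_residues hτ hsum (by
    rintro (i | i) (j | j) hij
    · exact hlam i j fun h => hij (h ▸ rfl)
    · exact hlammu i j
    · simp only [Sum.elim_inl, Sum.elim_inr]
      rw [theta_sub_comm]
      exact neg_ne_zero.mpr (hlammu j i)
    · exact hmu i j fun h => hij (h ▸ rfl))
  have hinl : ∀ k : Fin n, (Finset.univ : Finset (Fin n ⊕ Fin n)).erase (Sum.inl k) =
      (Finset.univ.erase k).disjSum Finset.univ := fun k => by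
    ext (i | i) <;> simp
  have hinr : ∀ k : Fin n, (Finset.univ : Finset (Fin n ⊕ Fin n)).erase (Sum.inr k) =
      Finset.univ.disjSum (Finset.univ.erase k) := fun k => by
    ext (i | i) <;> simp
  rw [Fintype.sum_sum_type] at hres
  simp only [hinl, hinr, Finset.prod_disjSum, Sum.elim_inl, Sum.elim_inr] at hres
  have hε : ((-1 : ℂ) ^ (n - 1)) = 1 ∨ ((-1 : ℂ) ^ (n - 1)) = -1 := neg_one_pow_eq_or ℂ _
  have hsub : ∀ (a : ℂ) (l : Fin n), a - (mu l - δ) = a - mu l + δ := fun a l => by ring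
  have hL : ∀ k, explicitMatrix τ η mu lam w (CCoeff τ η lam mu) k' k * tCoeff τ η c lam mu k *
        f (K - lam k) = (-1) ^ (n - 1) / theta τ w * (CCoeff τ η lam mu k' * Complex.exp c *
          ∏ l, theta τ (lam l - mu k' + δ)) * (g (lam k) /
          ((∏ l ∈ Finset.univ.erase k, theta τ (lam k - lam l)) *
            ∏ l, theta τ (lam k - mu l))) := by
    intro k
    simp only [explicitMatrix, Matrix.of_apply, tCoeff, ← hδ, hgdef, Finset.prod_div_distrib]
    rw [prod_theta_sub_swap,
      ← Finset.mul_prod_erase _ (fun l => theta τ (lam k - mu l + δ)) (Finset.mem_univ k'),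
      ← Finset.mul_prod_erase _ (fun l => theta τ (lam l - mu k' + δ)) (Finset.mem_univ k),
      show lam k - (mu k' - δ - w) = w + lam k - mu k' + δ by ring]
    simp only [hsub]
    rcases hε with h | h <;> rw [h] <;> ring
  have hR : ∀ k, explicitMatrix τ η mu mu w (tTildeCoeff τ η c lam mu) k' k *
        CCoeff τ η lam mu k * f (K - mu k) =
        (-1) ^ (n - 1) / theta τ w * (tTildeCoeff τ η c lam mu k' *
          ∏ l, theta τ (mu l - mu k' + δ)) * (g (mu k) /
          ((∏ l, theta τ (mu k - lam l)) *
            ∏ l ∈ Finset.univ.erase k, theta τ (mu k - mu l))) := by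
    intro k
    have h1 : CCoeff τ η lam mu k = (theta τ (mu k - mu k' + δ) *
        ∏ l ∈ Finset.univ.erase k', theta τ (mu k - (mu l - δ))) / ∏ l, theta τ (mu k - lam l) := by
      rw [CCoeff, ← Finset.mul_prod_erase _ _ (Finset.mem_univ k'), ← hδ,
        ← Finset.mul_prod_erase _ (fun l => theta τ (mu k - lam l)) (Finset.mem_univ k'),
        mul_div_mul_comm, ← Finset.prod_div_distrib, theta_sub_comm τ (lam k') (mu k),
        show mu k' - mu k - δ = -(mu k - mu k' + δ) by ring, theta_neg, neg_div_neg_eq]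
      congr 1
      refine Finset.prod_congr rfl fun l _ => ?_
      rw [theta_sub_comm τ (lam l) (mu k), show mu l - mu k - δ = -(mu k - (mu l - δ)) by ring,
        theta_neg, neg_div_neg_eq]
    simp only [explicitMatrix, Matrix.of_apply, h1, ← hδ, hgdef, Finset.prod_div_distrib]
    rw [prod_theta_sub_swap,
      ← Finset.mul_prod_erase _ (fun l => theta τ (mu l - mu k' + δ)) (Finset.mem_univ k),
      show mu k - (mu k' - δ - w) = w + mu k - mu k' + δ by ring]
    rcases hε with h | h <;> rw [h] <;> ring
  rw [Finset.sum_congr rfl fun k _ => hL k, Finset.sum_congr rfl fun k _ => hR k,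
    ← Finset.mul_sum, ← Finset.mul_sum, CCoeff_mul_exp hmuη]
  linear_combination (-((-1) ^ (n - 1) / theta τ w * (tTildeCoeff τ η c lam mu k' *
          ∏ l, theta τ (mu l - mu k' + δ)))) * hres

/-! ### The eigenvector -/

/-- The vector `sVec` consists of the values of `z ↦ ∏ θ(η/n - z - μ_l)` at the points `-λ_k`,
and interpolation gives the value of this function at `η/n - y_{k'}`. -/
lemma explicitMatrix_mulVec_sVec {n : ℕ} (hn : 0 < n) {τ : ℂ} (hτ : 0 < τ.im) {η w : ℂ}
    {lam mu : Fin n → ℂ} (y a : Fin n → ℂ) (hlam : ∀ i j, i ≠ j → theta τ (lam i - lam j) ≠ 0)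
    (hw : theta τ w ≠ 0) (hsum : w + η + ∑ k, lam k = ∑ k, mu k) (k' : Fin n) :
    (explicitMatrix τ η y lam w a *ᵥ sVec τ η lam mu) k' = a k' * ∏ l, theta τ (y k' - mu l) := by
  have hn' : (n : ℂ) ≠ 0 := by exact_mod_cast hn.ne'
  have hf : IsTheta τ n (n * (η / n) - ∑ k, mu k) fun z => ∏ l, theta τ (η / n - z - mu l) := by
    have := (isTheta_prod hτ Finset.univ mu).comp_const_sub (η / n)
    exact this.of_eq (Finset.card_fin n) (by rw [Finset.card_fin])
  have h := hf.sum_explicitMatrix_mul hτ (η := η) y a hlam hw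
    (by rw [mul_div_cancel₀ _ hn']; linear_combination hsum) k'
  simp only [sub_sub_cancel, sub_neg_eq_add] at h
  rw [← h, Matrix.mulVec, dotProduct]
  simp only [sVec, add_comm]

end EllipticRS

end

open EllipticRS in
theorem mainTheorem2 (n : ℕ) (hn : 0 < n) (τ : ℂ) (hτ : 0 < τ.im)
    (η u v c : ℂ) (lam mu : Fin n → ℂ)
    (hlam : ∀ i j, i ≠ j → theta τ (lam i - lam j) ≠ 0)
    (hmu : ∀ i j, i ≠ j → theta τ (mu i - mu j) ≠ 0)
    (hlammu : ∀ i j, theta τ (lam i - mu j) ≠ 0)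
    (hmuη : ∀ i j, i ≠ j → theta τ (mu i - mu j + η / (n : ℂ)) ≠ 0)
    (hv : v = u + ∑ k, (lam k - mu k)) :
    (∀ z : ℂ, theta τ (z - v - η) ≠ 0 →
      -- the inverses of the matrices of intertwining vectors exist
      IsUnit (phi τ lam (z - v - η)) ∧ IsUnit (phi τ mu (z - v - η)) ∧
      -- the discrete Lax equation
      MOp τ η u v mu (CCoeff τ η lam mu) z * LOp τ η v lam (tCoeff τ η c lam mu) z =
        LOp τ η v mu (tTildeCoeff τ η c lam mu) z * MOp τ η u v mu (CCoeff τ η lam mu) z ∧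
      -- the three operators in the degree-zero gauge
      degZero τ lam lam (z - v - η) (LOp τ η v lam (tCoeff τ η c lam mu) z) =
        explicitMatrix τ η lam lam (z - v - η) (tCoeff τ η c lam mu) ∧
      degZero τ mu mu (z - v - η) (LOp τ η v mu (tTildeCoeff τ η c lam mu) z) =
        explicitMatrix τ η mu mu (z - v - η) (tTildeCoeff τ η c lam mu) ∧
      degZero τ mu lam (z - v - η) (MOp τ η u v mu (CCoeff τ η lam mu) z) =
        explicitMatrix τ η mu lam (z - v - η) (CCoeff τ η lam mu)) ∧
    -- the eigenvector of `L(u)` and the kernel of `M(u)` in the degree-zero gauge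
    (theta τ (u - v - η) ≠ 0 →
      degZero τ lam lam (u - v - η) (LOp τ η v lam (tCoeff τ η c lam mu) u) *ᵥ
          sVec τ η lam mu = Complex.exp c • sVec τ η lam mu ∧
      degZero τ mu lam (u - v - η) (MOp τ η u v mu (CCoeff τ η lam mu) u) *ᵥ
          sVec τ η lam mu = 0 ∧
      ((∃ k, tCoeff τ η c lam mu k ≠ 0) → sVec τ η lam mu ≠ 0)) := by
  have hn' : (n : ℂ) ≠ 0 := by exact_mod_cast hn.ne'
  have hv' : v - u + ∑ k, mu k = ∑ k, lam k := by
    rw [hv, Finset.sum_sub_distrib]; ring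
  have gauge : ∀ z : ℂ, theta τ (z - v - η) ≠ 0 →
      degZero τ lam lam (z - v - η) (LOp τ η v lam (tCoeff τ η c lam mu) z) =
        explicitMatrix τ η lam lam (z - v - η) (tCoeff τ η c lam mu) ∧
      degZero τ mu mu (z - v - η) (LOp τ η v mu (tTildeCoeff τ η c lam mu) z) =
        explicitMatrix τ η mu mu (z - v - η) (tTildeCoeff τ η c lam mu) ∧
      degZero τ mu lam (z - v - η) (MOp τ η u v mu (CCoeff τ η lam mu) z) =
        explicitMatrix τ η mu lam (z - v - η) (CCoeff τ η lam mu) := by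
    intro z hz
    rw [LOp_eq_mul, LOp_eq_mul, MOp_eq_mul]
    exact ⟨degZero_eq_explicitMatrix hn hτ _ hlam hlam hz (by ring),
      degZero_eq_explicitMatrix hn hτ _ hmu hmu hz (by ring),
      degZero_eq_explicitMatrix hn hτ _ hlam hmu hz (by linear_combination hv')⟩
  refine ⟨fun z hz => ⟨isUnit_phi hn hτ hlam hz, isUnit_phi hn hτ hmu hz, ?_, gauge z hz⟩,
    fun hu => ⟨?_, ?_, ?_⟩⟩
  · have hM := explicitMatrix_eq_mul hn hτ (η := η) (z := z - u) (y := mu) (CCoeff τ η lam mu)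
      hlam hz (by linear_combination hv')
    have hL := explicitMatrix_eq_mul hn hτ (η := η) (z := z - v) (y := mu)
      (tTildeCoeff τ η c lam mu) hmu hz (by ring)
    -- Both sides of the Lax equation begin with `φ̄_μ(z - v - η)ᵀ`, which is left out.
    have key : explicitMatrix τ η mu lam (z - v - η) (CCoeff τ η lam mu) *
          Matrix.diagonal (tCoeff τ η c lam mu) * (phi τ lam (z - v))ᵀ =
        explicitMatrix τ η mu mu (z - v - η) (tTildeCoeff τ η c lam mu) *
          Matrix.diagonal (CCoeff τ η lam mu) * (phi τ mu (z - u))ᵀ := by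
      ext k' i
      have h := (isTheta_thetaIdx hn hτ i).lax_identity hτ (η := η) (c := c) (w := z - v - η)
        (K := (z - v + ∑ k, lam k) / n) hlam hmu hlammu hmuη
        (by rw [mul_div_cancel₀ _ hn']; ring) k'
      rw [Matrix.mul_apply, Matrix.mul_apply]
      simp only [Matrix.mul_diagonal, Matrix.transpose_apply, phi,
        Matrix.of_apply, barCoord, ← mul_div_assoc, ← Finset.sum_div]
      congr 1
      refine Eq.trans (Finset.sum_congr rfl fun k _ => ?_)
        (h.trans (Finset.sum_congr rfl fun k _ => ?_))
      · congr 2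
        ring
      · congr 2
        field_simp
        linear_combination -hv'
    rw [hM, hL] at key
    rw [MOp_eq_mul, LOp_eq_mul, LOp_eq_mul]
    simp only [Matrix.mul_assoc] at key ⊢
    rw [key]
  · rw [(gauge u hu).1]
    funext k
    rw [explicitMatrix_mulVec_sVec hn hτ _ _ hlam hu (by linear_combination -hv'), Pi.smul_apply,
      smul_eq_mul, tCoeff, Finset.prod_div_distrib, mul_assoc, div_mul_cancel₀, sVec]
    · congr 1
      exact Finset.prod_congr rfl fun l _ => by rw [sub_add_eq_add_sub]
    · exact Finset.prod_ne_zero_iff.mpr fun l _ => hlammu k l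
  · rw [(gauge u hu).2.2]
    funext k
    rw [explicitMatrix_mulVec_sVec hn hτ _ _ hlam hu (by linear_combination -hv'),
      Finset.prod_eq_zero (Finset.mem_univ k) (by rw [sub_self, theta_zero]), mul_zero,
      Pi.zero_apply]
  · rintro ⟨k, hk⟩ h0
    apply hk
    have h1 : ∏ l, theta τ (lam k - mu l + η / n) = 0 := by
      rw [← Pi.zero_apply (M := fun _ => ℂ) k, ← h0, sVec]
      exact Finset.prod_congr rfl fun l _ => by rw [sub_add_eq_add_sub]
    rw [tCoeff, Finset.prod_div_distrib, h1, zero_div, mul_zero]
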